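/- **Setting.** Let $V$ be a $\mathbb C$-vector space of dimension $n$ and let $G\subset GL(V)$ be a finite complex reflection group, i.e. a finite group generated by reflections (diagonalizable elements all but one of whose eigenvalues are $1$). Let $\mathbb C[V]$ be the symmetric algebra of $V^*$, on which $h\in GL(V)$ acts by $(h\cdot F)(v)=F(h^{-1}v)$; write $\xi[h]:\mathbb C[V]\to\mathbb C[V]$ for this action, i.e. for the algebra automorphism induced by $z\mapsto h\cdot z$ on $V^*$. A *set of basic invariants* is a family $x^1,\dots,x^n$ of algebraically independent homogeneous generators of $\mathbb C[V]^G$, of degrees $d_1\le\dots\le d_n$; the degrees depend only on $G$. For $a,b\in\mathbb Z_{\ge0}^n$ put $d\cdot b=\sum_\alpha d_\alpha b_\alpha$, $b!=\prod_\alpha b_\alpha!$, $z^b=\prod_\alpha (z^\alpha)^{b_\alpha}$, $x^a=\prod_\alpha (x^\alpha)^{a_\alpha}$, $[x-x(q)]^a=\prod_\alpha (x^\alpha-x^\alpha(q))^{a_\alpha}$. A triplet $(g,\zeta,q)$ with $g\in G$, $\zeta\in\mathbb C$, $q\in V$ is *admissible* if: $q$ is an eigenvector of $g$ with eigenvalue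 $\zeta$, a primitive $d_n$-th root of unity; the Jacobian matrix $\big(\frac{\partial x^\alpha}{\partial z^\beta}(q)\big)_{\alpha,\beta}$ is invertible, for a set of basic invariants $x$ and a basis $z$ of $V^*$ (this does not depend on $x$ and $z$); and the eigenvalues of $g$ on $V$, with multiplicity, are $\zeta^{1-d_\alpha}$ $(1\le\alpha\le n)$. A basis $z^1,\dots,z^n$ of $V^*$ is *adapted* to $(g,\zeta,q)$ if $g\cdot z^\alpha=\zeta^{d_\alpha-1}z^\alpha$ for all $\alpha$. Given an admissible triplet, an adapted basis $z$ and a set of basic invariants $x$, let $V(g,\zeta,q)(j)$ be the span of the $z^b$ with $d\cdot b=j$ $(j\in\mathbb Z_{\ge 0})$, and let $$\varphi[g,\zeta,q],\ \psi[g,\zeta,q]:\mathbb C[V]^G\to\mathbb C[V]$$ be the linear maps with $$\varphi[g,\zeta,q](x^a)=\sum_{b\in\mathbb Z_{\ge0}^n}\frac1{b!}\frac{\partial^b[x-x(q)]^a}{\partial z^b}(q)\,z^b,\qquad \psi[g,\zeta,q](x^a)=\sum_{d\cdot b=d\cdot a}\frac1{b!}\frac{\partial^b[x-x(q)]^a}{\partial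 z^b}(q)\,z^b .$$ Two admissible triplets are *equivalent*, $(g,\zeta,q)\sim(g',\zeta',q')$, if $\psi[g,\zeta,q]^{-1}(V^*)=\psi[g',\zeta',q']^{-1}(V^*)$; a set of basic invariants is good for the triplet when it is a basis of this space. **Statement.** Let $(g,\zeta,q)$ be an admissible triplet. Then adapted bases exist, and the following hold, whichever sets of basic invariants and adapted bases are used to compute the gradings and maps on the two sides of each formula. (i) For $h\in G$ the triplet $(hgh^{-1},\zeta,h\cdot q)$ is admissible; $\xi[h]$ preserves $V^*$ and $\mathbb C[V]^G$, it maps $V(g,\zeta,q)(j)$ isomorphically onto $V(hgh^{-1},\zeta,h\cdot q)(j)$ for every $j$, and $$\varphi[hgh^{-1},\zeta,h\cdot q]\circ\xi[h]=\xi[h]\circ\varphi[g,\zeta,q],\qquad \psi[hgh^{-1},\zeta,h\cdot q]\circ\xi[h]=\xi[h]\circ\psi[g,\zeta,q].$$ (ii) For $t\in\mathbb C^*$ the triplet $(g,\zeta,t q)$ is admissible; $\xi[t\,\mathrm{id}_V]$ preserves $V^*$ and $\mathbb C[V]^G$, it maps $V(g,\zeta,q)(j)$ isomorphically onto $V(g,\zeta,tq)(j)$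 for every $j$, and $$\varphi[g,\zeta,tq]\circ\xi[t\,\mathrm{id}_V]=\xi[t\,\mathrm{id}_V]\circ\varphi[g,\zeta,q],\qquad \psi[g,\zeta,tq]\circ\xi[t\,\mathrm{id}_V]=\xi[t\,\mathrm{id}_V]\circ\psi[g,\zeta,q].$$ (iii) For $r\in\mathbb Z$ with $\gcd(r,d_n)=1$ the triplet $(g^r,\zeta^r,q)$ is admissible, and $$V(g,\zeta,q)(j)=V(g^r,\zeta^r,q)(j)\ (\forall j),\qquad \varphi[g,\zeta,q]=\varphi[g^r,\zeta^r,q],\qquad \psi[g,\zeta,q]=\psi[g^r,\zeta^r,q].$$ Consequently, for all $h\in G$, $t\in\mathbb C^*$ and $r\in\mathbb Z$ with $\gcd(r,d_n)=1$, $$(g,\zeta,q)\sim(hgh^{-1},\zeta,h\cdot q),\qquad (g,\zeta,q)\sim(g,\zeta,tq),\qquad (g^r,\zeta^r,q)\sim(g,\zeta,q).$$ -/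

import Mathlib

noncomputable section

namespace GoodInv

open Module

variable {V : Type*} [AddCommGroup V] [Module ℂ V] {n : ℕ}

/-! ### Complex reflection groups -/

/-- A reflection of `V`: a diagonalizable automorphism all but one of whose eigenvalues
(counted with multiplicity) are equal to `1`. -/
def IsReflection (s : V ≃ₗ[ℂ] V) : Prop :=
  ∃ (b : Basis (Fin (finrank ℂ V)) ℂ V) (i : Fin (finrank ℂ V)) (c : ℂ),
    c ≠ 1 ∧ s (b i) = c • b i ∧ ∀ j, j ≠ i → s (b j) = b j

/-- `G ⊂ GL(V)` is a finite complex reflection group: it is finite and generated by the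
reflections that it contains. -/
def IsComplexReflectionGroup (G : Subgroup (V ≃ₗ[ℂ] V)) : Prop :=
  Finite G ∧ Subgroup.closure {s : V ≃ₗ[ℂ] V | s ∈ G ∧ IsReflection s} = G

/-! ### The algebra `ℂ[V]` of polynomial functions -/

variable (V) in
/-- `ℂ[V]`, the symmetric algebra of `V*`. -/
abbrev PolyAlg : Type _ := SymmetricAlgebra ℂ (Dual ℂ V)

variable (V) in
/-- The natural inclusion `V* ⊂ ℂ[V]`, as a linear map. -/
abbrev incl : Dual ℂ V →ₗ[ℂ] PolyAlg V := SymmetricAlgebra.ι ℂ (Dual ℂ V)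

variable (V) in
/-- `V*` as a subspace of `ℂ[V]`. -/
def linearForms : Submodule ℂ (PolyAlg V) := LinearMap.range (incl V)

variable (V) in
/-- The degree `k` part of `ℂ[V]` for its natural grading: the span of the `k`-fold products
of linear forms. -/
def degreePart (k : ℕ) : Submodule ℂ (PolyAlg V) := linearForms V ^ k

/-- The value `F(v)` of the polynomial function `F ∈ ℂ[V]` at `v ∈ V`. -/
def evalAt (v : V) : PolyAlg V →ₐ[ℂ] ℂ := SymmetricAlgebra.lift (Dual.eval ℂ V v)

/-- The action of `h ∈ GL(V)` on `V*`: `(h · z)(v) = z(h⁻¹ v)`. -/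
def dualAct (h : V ≃ₗ[ℂ] V) : Dual ℂ V ≃ₗ[ℂ] Dual ℂ V := h.symm.dualMap

/-- `ξ[h] : ℂ[V] → ℂ[V]` for `h ∈ GL(V)`: the algebra automorphism with `z ↦ h · z` for
`z ∈ V*`; it is at the same time the action `(h · F)(v) = F(h⁻¹ v)` on polynomial functions
(see `evalAt_xi`). -/
def xi (h : V ≃ₗ[ℂ] V) : PolyAlg V ≃ₐ[ℂ] PolyAlg V :=
  AlgEquiv.ofAlgHom
    (SymmetricAlgebra.lift (incl V ∘ₗ (dualAct h).toLinearMap))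
    (SymmetricAlgebra.lift (incl V ∘ₗ (dualAct h).symm.toLinearMap))
    (SymmetricAlgebra.algHom_ext (LinearMap.ext fun z => by simp))
    (SymmetricAlgebra.algHom_ext (LinearMap.ext fun z => by simp))

theorem xi_incl (h : V ≃ₗ[ℂ] V) (z : Dual ℂ V) : xi h (incl V z) = incl V (dualAct h z) := by
  simp [xi]

theorem evalAt_incl (v : V) (z : Dual ℂ V) : evalAt v (incl V z) = z v := by
  simp [evalAt]

theorem evalAt_xi (h : V ≃ₗ[ℂ] V) (F : PolyAlg V) (v : V) :
    evalAt v (xi h F) = evalAt (h⁻¹ v) F := by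
  have : (evalAt v).comp (xi h : PolyAlg V →ₐ[ℂ] PolyAlg V) = evalAt (h⁻¹ v) := by
    refine SymmetricAlgebra.algHom_ext (LinearMap.ext fun z => ?_)
    change evalAt v (xi h (incl V z)) = evalAt (h⁻¹ v) (incl V z)
    rw [xi_incl, evalAt_incl, evalAt_incl]
    rfl
  exact congrArg (fun f => f F) this

/-- The algebra `ℂ[V]^G` of `G`-invariants. -/
def invariants (G : Subgroup (V ≃ₗ[ℂ] V)) : Subalgebra ℂ (PolyAlg V) where
  carrier := {F | ∀ g ∈ G, xi g F = F}
  mul_mem' ha hb g hg := by rw [map_mul, ha g hg, hb g hg]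
  add_mem' ha hb g hg := by rw [map_add, ha g hg, hb g hg]
  algebraMap_mem' c g _ := AlgEquiv.commutes _ c

/-! ### Basic invariants -/

/-- A set of basic invariants of `G` with degrees `d = (d₁ ≤ ⋯ ≤ dₙ)`: algebraically independent
homogeneous generators `x¹, …, xⁿ` of the algebra `ℂ[V]^G`, with `deg x^α = d_α`. -/
structure BasicInvariants (G : Subgroup (V ≃ₗ[ℂ] V)) (d : Fin n → ℕ) where
  x : Fin n → invariants G
  homogeneous : ∀ α, (x α : PolyAlg V) ∈ degreePart V (d α)
  algebraicIndependent : AlgebraicIndependent ℂ x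
  adjoin_eq_top : Algebra.adjoin ℂ (Set.range x) = ⊤
  monotone : Monotone d

namespace BasicInvariants

variable {G : Subgroup (V ≃ₗ[ℂ] V)} {d : Fin n → ℕ}

theorem aeval_bijective (x : BasicInvariants G d) :
    Function.Bijective (MvPolynomial.aeval (R := ℂ) x.x) := by
  refine ⟨x.algebraicIndependent, ?_⟩
  rw [← AlgHom.range_eq_top, ← Algebra.adjoin_range_eq_range_aeval, x.adjoin_eq_top]

/-- The `ℂ`-basis `x^a = (x¹)^{a₁} ⋯ (xⁿ)^{aₙ}`, `a ∈ ℤ_{≥0}ⁿ`, of `ℂ[V]^G`. -/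
def monomialBasis (x : BasicInvariants G d) : Basis (Fin n →₀ ℕ) ℂ (invariants G) :=
  (MvPolynomial.basisMonomials (Fin n) ℂ).map
    (AlgEquiv.ofBijective (MvPolynomial.aeval (R := ℂ) x.x) x.aeval_bijective).toLinearEquiv

theorem monomialBasis_apply (x : BasicInvariants G d) (a : Fin n →₀ ℕ) :
    x.monomialBasis a = ∏ α, x.x α ^ a α := by
  simp [monomialBasis, MvPolynomial.aeval_monomial, Finsupp.prod_fintype]

/-- `[x - x(q)]^a = (x¹ - x¹(q))^{a₁} ⋯ (xⁿ - xⁿ(q))^{aₙ}`. -/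
def shiftedMonomial (x : BasicInvariants G d) (q : V) (a : Fin n →₀ ℕ) : PolyAlg V :=
  ∏ α, ((x.x α : PolyAlg V) - algebraMap ℂ (PolyAlg V) (evalAt q (x.x α))) ^ a α

end BasicInvariants

/-! ### Coordinates and derivatives -/

/-- `d · b = d₁ b₁ + ⋯ + dₙ bₙ`. -/
def dot (d : Fin n → ℕ) (b : Fin n →₀ ℕ) : ℕ := ∑ α, d α * b α

/-- The monomial `z^b = (z¹)^{b₁} ⋯ (zⁿ)^{bₙ}` in a basis `z` of `V*`. -/
def zMonomial (z : Basis (Fin n) ℂ (Dual ℂ V)) (b : Fin n →₀ ℕ) : PolyAlg V :=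
  ∏ β, incl V (z β) ^ b β

/-- The partial derivative `∂/∂z^β` on `ℂ[V] = ℂ[z¹, …, zⁿ]`. -/
def partialDeriv (z : Basis (Fin n) ℂ (Dual ℂ V)) (β : Fin n) : Module.End ℂ (PolyAlg V) :=
  (SymmetricAlgebra.equivMvPolynomial z).symm.toLinearMap ∘ₗ
    (MvPolynomial.pderiv (R := ℂ) β).toLinearMap ∘ₗ
      (SymmetricAlgebra.equivMvPolynomial z).toLinearMap

/-- `∂^b/∂z^b = (∂/∂z¹)^{b₁} ∘ ⋯ ∘ (∂/∂zⁿ)^{bₙ}`. -/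
def iterDeriv (z : Basis (Fin n) ℂ (Dual ℂ V)) (b : Fin n →₀ ℕ) : Module.End ℂ (PolyAlg V) :=
  ((List.finRange n).map fun β => partialDeriv z β ^ b β).prod

/-- The `b`-th term `(1/b!) (∂^b F/∂z^b)(q) z^b` of the Taylor expansion of `F` at `q`. -/
def taylorTerm (z : Basis (Fin n) ℂ (Dual ℂ V)) (q : V) (F : PolyAlg V) (b : Fin n →₀ ℕ) :
    PolyAlg V :=
  ((∏ β, ((b β).factorial : ℂ))⁻¹ * evalAt q (iterDeriv z b F)) • zMonomial z b

/-- The Jacobian matrix `(∂x^α/∂z^β (q))_{α, β}`. -/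
def jacobian {G : Subgroup (V ≃ₗ[ℂ] V)} {d : Fin n → ℕ} (x : BasicInvariants G d)
    (z : Basis (Fin n) ℂ (Dual ℂ V)) (q : V) : Matrix (Fin n) (Fin n) ℂ :=
  Matrix.of fun α β => evalAt q (partialDeriv z β (x.x α))

/-! ### Admissible triplets -/

/-- The largest degree `dₙ` of a sequence `d₁ ≤ ⋯ ≤ dₙ`. -/
def topDegree (d : Fin n → ℕ) : ℕ := Finset.univ.sup d

/-- The triplet `(g, ζ, q)` is admissible for the group `G` with degrees `d`. The invertibility
of the Jacobian matrix does not depend on the basic invariants and linear coordinates chosen.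
The eigenvalues of `g` are counted with multiplicity. -/
structure IsAdmissible [FiniteDimensional ℂ V] (G : Subgroup (V ≃ₗ[ℂ] V)) (d : Fin n → ℕ)
    (g : V ≃ₗ[ℂ] V) (ζ : ℂ) (q : V) : Prop where
  mem : g ∈ G
  eigenvector : End.HasEigenvector (g : V →ₗ[ℂ] V) ζ q
  primitive : IsPrimitiveRoot ζ (topDegree d)
  jacobian_invertible : ∃ (x : BasicInvariants G d) (z : Basis (Fin n) ℂ (Dual ℂ V)),
    IsUnit (jacobian x z q)
  eigenvalues : (g : V →ₗ[ℂ] V).charpoly =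
    ∏ α, (Polynomial.X - Polynomial.C (ζ ^ (1 - (d α : ℤ))))

/-- The basis `z` of `V*` is adapted to the triplet: `g · z^α = ζ^{d_α - 1} z^α` for all `α`. -/
def IsAdapted (d : Fin n → ℕ) (g : V ≃ₗ[ℂ] V) (ζ : ℂ) (z : Basis (Fin n) ℂ (Dual ℂ V)) : Prop :=
  ∀ α, dualAct g (z α) = ζ ^ ((d α : ℤ) - 1) • z α

/-- `V(g, ζ, q)(j)`, the span of the monomials `z^b` with `d · b = j`, where `z` is a basis of
`V*` adapted to `(g, ζ, q)`. -/
def gradedPart (d : Fin n → ℕ) (z : Basis (Fin n) ℂ (Dual ℂ V)) (j : ℕ) :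
    Submodule ℂ (PolyAlg V) :=
  Submodule.span ℂ {F | ∃ b : Fin n →₀ ℕ, dot d b = j ∧ F = zMonomial z b}

/-! ### The morphisms `φ` and `ψ` -/

section morphisms

variable {G : Subgroup (V ≃ₗ[ℂ] V)} {d : Fin n → ℕ}

/-- `φ[g, ζ, q] : ℂ[V]^G → ℂ[V]`, computed with the basic invariants `x` and the adapted
basis `z`. Only finitely many terms of the sum are nonzero (see `finite_taylorTerm_ne_zero`). -/
def phi (x : BasicInvariants G d) (z : Basis (Fin n) ℂ (Dual ℂ V)) (q : V) :
    invariants G →ₗ[ℂ] PolyAlg V :=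
  x.monomialBasis.constr ℂ fun a => ∑ᶠ b : Fin n →₀ ℕ, taylorTerm z q (x.shiftedMonomial q a) b

/-- `ψ[g, ζ, q] : ℂ[V]^G → ℂ[V]`, computed with the basic invariants `x` and the adapted
basis `z`: only the terms with `d · b = d · a` of `φ[g, ζ, q](x^a)` are kept. -/
def psi (x : BasicInvariants G d) (z : Basis (Fin n) ℂ (Dual ℂ V)) (q : V) :
    invariants G →ₗ[ℂ] PolyAlg V :=
  x.monomialBasis.constr ℂ fun a =>
    ∑ᶠ (b : Fin n →₀ ℕ) (_ : dot d b = dot d a), taylorTerm z q (x.shiftedMonomial q a) b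

/-- The space `ψ[g, ζ, q]⁻¹(V*)`, of which the good basic invariants are the bases. -/
def goodSpace (x : BasicInvariants G d) (z : Basis (Fin n) ℂ (Dual ℂ V)) (q : V) :
    Submodule ℂ (invariants G) :=
  (linearForms V).comap (psi x z q)

end morphisms

/-- The equivalence `(g, ζ, q) ∼ (g', ζ', q')` of admissible triplets:
`ψ[g, ζ, q]⁻¹(V*) = ψ[g', ζ', q']⁻¹(V*)`, whatever basic invariants and adapted bases are used
to compute the two sides. -/
def TripletEquiv [FiniteDimensional ℂ V] (G : Subgroup (V ≃ₗ[ℂ] V)) (d : Fin n → ℕ)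
    (g : V ≃ₗ[ℂ] V) (ζ : ℂ) (q : V) (g' : V ≃ₗ[ℂ] V) (ζ' : ℂ) (q' : V) : Prop :=
  IsAdmissible G d g ζ q ∧ IsAdmissible G d g' ζ' q' ∧
    ∀ (x x' : BasicInvariants G d) (z z' : Basis (Fin n) ℂ (Dual ℂ V)),
      IsAdapted d g ζ z → IsAdapted d g' ζ' z' → goodSpace x z q = goodSpace x' z' q'

/-! ### The Taylor sums are finite -/

theorem pderiv_pow_monomial (β : Fin n) (k : ℕ) (s : Fin n →₀ ℕ) (c : ℂ) :
    ∃ (s' : Fin n →₀ ℕ) (c' : ℂ),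
      ((MvPolynomial.pderiv (R := ℂ) β).toLinearMap ^ k : Module.End ℂ (MvPolynomial (Fin n) ℂ))
        (MvPolynomial.monomial s c) = MvPolynomial.monomial s' c' ∧
      (∀ γ, γ ≠ β → s' γ = s γ) ∧ s' β = s β - k ∧ ((c = 0 ∨ s β < k) → c' = 0) := by
  induction k with
  | zero => exact ⟨s, c, by simp, by simp, by simp, by simp⟩
  | succ k ih =>
    obtain ⟨s', c', h1, h2, h3, h4⟩ := ih
    refine ⟨s' - Finsupp.single β 1, c' * s' β, ?_, ?_, ?_, ?_⟩
    · rw [pow_succ', Module.End.mul_apply, h1]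
      exact MvPolynomial.pderiv_monomial
    · intro γ hγ
      simp [h2 γ hγ, Finsupp.single_eq_of_ne hγ]
    · simp [h3]; omega
    · rintro (h | h)
      · simp [h4 (Or.inl h)]
      · have : s' β = 0 := by omega
        simp [this]

theorem iterate_pderiv_monomial (b : Fin n → ℕ) (l : List (Fin n)) (hl : l.Nodup)
    (s : Fin n →₀ ℕ) (c : ℂ) :
    ∃ (s' : Fin n →₀ ℕ) (c' : ℂ),
      ((l.map fun β => ((MvPolynomial.pderiv (R := ℂ) β).toLinearMap ^ b β :
          Module.End ℂ (MvPolynomial (Fin n) ℂ))).prod)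
        (MvPolynomial.monomial s c) = MvPolynomial.monomial s' c' ∧
      (∀ γ, γ ∉ l → s' γ = s γ) ∧ ((∃ γ ∈ l, s γ < b γ) → c' = 0) := by
  induction l with
  | nil => exact ⟨s, c, by simp, by simp, by simp⟩
  | cons β l ih =>
    obtain ⟨hβ, hl'⟩ := List.nodup_cons.mp hl
    obtain ⟨s', c', h1, h2, h3⟩ := ih hl'
    obtain ⟨s'', c'', k1, k2, -, k4⟩ := pderiv_pow_monomial β (b β) s' c'
    refine ⟨s'', c'', ?_, ?_, ?_⟩
    · rw [List.map_cons, List.prod_cons, Module.End.mul_apply, h1, k1]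
    · intro γ hγ
      rw [List.mem_cons, not_or] at hγ
      rw [k2 γ hγ.1, h2 γ hγ.2]
    · rintro ⟨γ, hγ, hlt⟩
      rcases List.mem_cons.mp hγ with rfl | hγ
      · exact k4 (Or.inr (by rwa [h2 γ hβ]))
      · exact k4 (Or.inl (h3 ⟨γ, hγ, hlt⟩))

theorem iterDeriv_apply (z : Basis (Fin n) ℂ (Dual ℂ V)) (b : Fin n →₀ ℕ) (F : PolyAlg V) :
    SymmetricAlgebra.equivMvPolynomial z (iterDeriv z b F) =
      ((List.finRange n).map fun β => ((MvPolynomial.pderiv (R := ℂ) β).toLinearMap ^ b β :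
          Module.End ℂ (MvPolynomial (Fin n) ℂ))).prod
        (SymmetricAlgebra.equivMvPolynomial z F) := by
  have hpow : ∀ (β : Fin n) (k : ℕ) (F : PolyAlg V),
      SymmetricAlgebra.equivMvPolynomial z ((partialDeriv z β ^ k) F) =
        ((MvPolynomial.pderiv (R := ℂ) β).toLinearMap ^ k :
          Module.End ℂ (MvPolynomial (Fin n) ℂ)) (SymmetricAlgebra.equivMvPolynomial z F) := by
    intro β k
    induction k with
    | zero => intro F; simp
    | succ k ih =>
      intro F
      rw [pow_succ, pow_succ, Module.End.mul_apply, Module.End.mul_apply, ih]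
      simp [partialDeriv]
  unfold iterDeriv
  induction List.finRange n with
  | nil => simp
  | cons β l ih =>
    rw [List.map_cons, List.prod_cons, Module.End.mul_apply, hpow, ih, List.map_cons,
      List.prod_cons, Module.End.mul_apply]

theorem finite_taylorTerm_ne_zero (z : Basis (Fin n) ℂ (Dual ℂ V)) (q : V) (F : PolyAlg V) :
    {b | taylorTerm z q F b ≠ 0}.Finite := by
  set P := SymmetricAlgebra.equivMvPolynomial z F with hP
  refine (Set.Finite.biUnion P.support.finite_toSet
    fun s _ => Set.finite_Iic s).subset fun b hb => ?_
  by_contra hcon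
  simp only [Set.mem_iUnion, Set.mem_Iic, not_exists] at hcon
  apply hb
  have : iterDeriv z b F = 0 := by
    apply (SymmetricAlgebra.equivMvPolynomial z).injective
    rw [iterDeriv_apply, map_zero, ← hP, P.as_sum, map_sum]
    refine Finset.sum_eq_zero fun s hs => ?_
    obtain ⟨s', c', h1, -, h3⟩ :=
      iterate_pderiv_monomial b (List.finRange n) (List.nodup_finRange n) s (P.coeff s)
    obtain ⟨γ, hγ⟩ : ∃ γ, ¬ b γ ≤ s γ := by
      by_contra hno
      push Not at hno
      exact hcon s hs hno
    rw [h1, h3 ⟨γ, List.mem_finRange γ, not_le.mp hγ⟩, map_zero]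
  simp [taylorTerm, this]

end GoodInv

end

open GoodInv

noncomputable section

namespace GoodInv

open Module

variable {V : Type*} [AddCommGroup V] [Module ℂ V] {n : ℕ}

/-! ### Taylor expansion -/

/-! The Taylor sum of `F` at `q` is the polynomial function `v ↦ F(v + q)`. Hence `φ` is the algebra
morphism `x^α ↦ translate q x^α - x^α(q)`, which involves no coordinates `z`, and `ψ` cuts each
`φ(x^a)` down to its part of weight `d · a`.

Two rigidity facts remove the remaining choices. First, `g q = ζ q` and invariance give `ζ^{d_α}
x^α(q) = x^α(q)`, so `x^α(q) = 0` unless `d_α = d_n`. Consequently `φ(f) = translate q f - f(q)` for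
every homogeneous invariant `f` of degree between `1` and `d_n`, a formula free of `x` that covers
the members of any other set of basic invariants (`IsAdmissible.phiHom_apply`). Second, the
eigenvalue `ζ^{d_α - 1}` determines `d_α`, because `1 ≤ d_α ≤ d_n`; so a linear map intertwining `g`
and `g'` carries one grading to the other (`IsAdapted.incl_dualAct_mem`).

Since `ξ[h]` turns translation by `q` into translation by `h q`, both maps are equivariant under any
`h` with `h g = g' h` that multiplies the basic invariants by scalars (`IsAdmissible.phiHom_xi`,
`IsAdmissible.psi_xi`). Taking `h ∈ G` gives (i), `h` scalar gives (ii), and `h = 1` gives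
independence of `x` and `z`. The last yields (iii), as a basis adapted to `(g, ζ)` is adapted to
`(g^r, ζ^r)`.

The equivalences follow: `h ∈ G` fixes the invariants and `ξ[h]` preserves `V*`; for scalars one
also needs `ψ⁻¹(V*)` to be stable under rescaling, which holds because `ψ` respects the gradings. -/

theorem factorial_mul_coeff_pderiv_pow (β : Fin n) (k : ℕ) (P : MvPolynomial (Fin n) ℂ)
    (m : Fin n →₀ ℕ) :
    ((m β).factorial : ℂ) * MvPolynomial.coeff m
      (((MvPolynomial.pderiv (R := ℂ) β).toLinearMap ^ k :
        Module.End ℂ (MvPolynomial (Fin n) ℂ)) P) =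
      ((m β + k).factorial : ℂ) * MvPolynomial.coeff (m + Finsupp.single β k) P := by
  induction k generalizing P with
  | zero => simp
  | succ k ih =>
    rw [pow_succ, Module.End.mul_apply, ih]
    change _ * MvPolynomial.coeff _ (MvPolynomial.pderiv β P) = _
    rw [MvPolynomial.coeff_pderiv, add_assoc m, ← Finsupp.single_add, ← add_assoc (m β),
      Nat.factorial_succ]
    simp only [Finsupp.add_apply, Finsupp.single_eq_same]
    push_cast
    ring

/-- The directions in `l` are distinct, so each factor differentiates from exponent `0` in its own
variable and contributes exactly `b β !`. -/
theorem coeff_prod_pderiv_pow (b : Fin n → ℕ) (l : List (Fin n)) (hl : l.Nodup)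
    (P : MvPolynomial (Fin n) ℂ) (m : Fin n →₀ ℕ) (hm : ∀ γ ∈ l, m γ = 0) :
    MvPolynomial.coeff m ((l.map fun β => ((MvPolynomial.pderiv (R := ℂ) β).toLinearMap ^ b β :
        Module.End ℂ (MvPolynomial (Fin n) ℂ))).prod P) =
      (l.map fun β => ((b β).factorial : ℂ)).prod *
        MvPolynomial.coeff (m + (l.map fun β => Finsupp.single β (b β)).sum) P := by
  induction l generalizing m with
  | nil => simp
  | cons β l ih =>
    obtain ⟨hβ, hl'⟩ := List.nodup_cons.mp hl
    have h0 : m β = 0 := hm β List.mem_cons_self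
    have h1 := factorial_mul_coeff_pderiv_pow β (b β)
      ((l.map fun β => ((MvPolynomial.pderiv (R := ℂ) β).toLinearMap ^ b β :
        Module.End ℂ (MvPolynomial (Fin n) ℂ))).prod P) m
    rw [h0, Nat.factorial_zero, Nat.cast_one, one_mul, zero_add] at h1
    rw [List.map_cons, List.prod_cons, Module.End.mul_apply, h1, ih hl', List.map_cons,
      List.prod_cons, List.map_cons, List.sum_cons, mul_assoc, add_assoc]
    intro γ hγ
    have : γ ≠ β := fun h => hβ (h ▸ hγ)
    simp [hm γ (List.mem_cons_of_mem _ hγ), Finsupp.single_eq_of_ne this]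

theorem coeff_zero_iterDeriv (z : Basis (Fin n) ℂ (Dual ℂ V)) (b : Fin n →₀ ℕ) (F : PolyAlg V) :
    MvPolynomial.coeff 0 (SymmetricAlgebra.equivMvPolynomial z (iterDeriv z b F)) =
      (∏ β, ((b β).factorial : ℂ)) *
        MvPolynomial.coeff b (SymmetricAlgebra.equivMvPolynomial z F) := by
  rw [iterDeriv_apply, coeff_prod_pderiv_pow b _ (List.nodup_finRange n) _ _ (by simp),
    ← List.ofFn_eq_map, List.prod_ofFn, ← List.ofFn_eq_map, List.sum_ofFn, zero_add,
    Finsupp.univ_sum_single]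

theorem coeff_zero_equivMvPolynomial (z : Basis (Fin n) ℂ (Dual ℂ V)) (F : PolyAlg V) :
    MvPolynomial.coeff 0 (SymmetricAlgebra.equivMvPolynomial z F) = evalAt 0 F := by
  have : ((MvPolynomial.aeval fun _ : Fin n => (0 : ℂ)).comp
      (SymmetricAlgebra.equivMvPolynomial z : PolyAlg V →ₐ[ℂ] MvPolynomial (Fin n) ℂ)) =
      evalAt (0 : V) := by
    refine SymmetricAlgebra.algHom_ext (z.ext fun i => ?_)
    simp [evalAt]
  rw [← this]
  simp [MvPolynomial.constantCoeff_eq]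

/-- Translation by `q`: the algebra endomorphism of `ℂ[V]` with `F(v) ↦ F(v + q)`. -/
def translate (q : V) : PolyAlg V →ₐ[ℂ] PolyAlg V :=
  SymmetricAlgebra.lift (incl V + Algebra.linearMap ℂ (PolyAlg V) ∘ₗ Dual.eval ℂ V q)

theorem translate_incl (q : V) (w : Dual ℂ V) :
    translate q (incl V w) = incl V w + algebraMap ℂ _ (w q) := by
  simp [translate]

theorem evalAt_zero_translate (q : V) (F : PolyAlg V) :
    evalAt 0 (translate q F) = evalAt q F := by
  have : (evalAt 0).comp (translate q) = evalAt q := by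
    refine SymmetricAlgebra.algHom_ext (LinearMap.ext fun w => ?_)
    change evalAt 0 (translate q (incl V w)) = evalAt q (incl V w)
    simp [translate_incl, evalAt_incl]
  exact DFunLike.congr_fun this F

theorem equivMvPolynomial_translate (z : Basis (Fin n) ℂ (Dual ℂ V)) (q : V) (F : PolyAlg V) :
    SymmetricAlgebra.equivMvPolynomial z (translate q F) =
      MvPolynomial.bind₁ (fun i => MvPolynomial.X i + MvPolynomial.C (z i q))
        (SymmetricAlgebra.equivMvPolynomial z F) := by
  have : (SymmetricAlgebra.equivMvPolynomial z : PolyAlg V →ₐ[ℂ] _).comp (translate q) =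
      (MvPolynomial.bind₁ (fun i => (MvPolynomial.X i + MvPolynomial.C (z i q) :
        MvPolynomial (Fin n) ℂ))).comp (SymmetricAlgebra.equivMvPolynomial z) := by
    refine SymmetricAlgebra.algHom_ext (z.ext fun i => ?_)
    change SymmetricAlgebra.equivMvPolynomial z (translate q (incl V (z i))) =
      MvPolynomial.bind₁ _ (SymmetricAlgebra.equivMvPolynomial z (incl V (z i)))
    rw [translate_incl, map_add, AlgEquiv.commutes, SymmetricAlgebra.equivMvPolynomial_ι_apply,
      MvPolynomial.bind₁_X_right, MvPolynomial.algebraMap_eq]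
  exact DFunLike.congr_fun this F

theorem pderiv_bind₁_X_add_C (c : Fin n → ℂ) (β : Fin n) (P : MvPolynomial (Fin n) ℂ) :
    MvPolynomial.pderiv β
        (MvPolynomial.bind₁ (fun i => MvPolynomial.X i + MvPolynomial.C (c i)) P) =
      MvPolynomial.bind₁ (fun i => MvPolynomial.X i + MvPolynomial.C (c i))
        (MvPolynomial.pderiv β P) := by
  induction P using MvPolynomial.induction_on with
  | C a => simp [MvPolynomial.algebraMap_eq]
  | add p q hp hq => simp [hp, hq]
  | mul_X p i hp =>
    rw [map_mul, MvPolynomial.pderiv_mul, hp, MvPolynomial.pderiv_mul]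
    by_cases h : i = β
    · subst h; simp
    · simp [MvPolynomial.pderiv_X_of_ne h]

theorem partialDeriv_translate (z : Basis (Fin n) ℂ (Dual ℂ V)) (β : Fin n) (q : V)
    (F : PolyAlg V) :
    partialDeriv z β (translate q F) = translate q (partialDeriv z β F) := by
  apply (SymmetricAlgebra.equivMvPolynomial z).injective
  rw [equivMvPolynomial_translate]
  simp [partialDeriv, equivMvPolynomial_translate, pderiv_bind₁_X_add_C]

theorem iterDeriv_translate (z : Basis (Fin n) ℂ (Dual ℂ V)) (b : Fin n →₀ ℕ) (q : V)
    (F : PolyAlg V) : iterDeriv z b (translate q F) = translate q (iterDeriv z b F) := by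
  suffices h : Commute (iterDeriv z b) (translate q).toLinearMap from
    DFunLike.congr_fun h.eq F
  refine Commute.list_prod_left _ _ fun D hD => ?_
  obtain ⟨β, -, rfl⟩ := List.mem_map.mp hD
  exact Commute.pow_left (LinearMap.ext fun F => partialDeriv_translate z β q F) _

theorem equivMvPolynomial_zMonomial (z : Basis (Fin n) ℂ (Dual ℂ V)) (b : Fin n →₀ ℕ) :
    SymmetricAlgebra.equivMvPolynomial z (zMonomial z b) = MvPolynomial.monomial b 1 := by
  rw [zMonomial, map_prod, MvPolynomial.monomial_eq, Finsupp.prod_fintype _ _ (by simp)]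
  simp [SymmetricAlgebra.equivMvPolynomial_ι_apply]

/-- Derivatives commute with translation, so the derivative at `q` becomes a derivative at `0` of
the translate; there `1/b!` cancels the factorials produced by differentiating. -/
theorem equivMvPolynomial_taylorTerm (z : Basis (Fin n) ℂ (Dual ℂ V)) (q : V) (F : PolyAlg V)
    (b : Fin n →₀ ℕ) :
    SymmetricAlgebra.equivMvPolynomial z (taylorTerm z q F b) =
      MvPolynomial.monomial b
        (MvPolynomial.coeff b (SymmetricAlgebra.equivMvPolynomial z (translate q F))) := by
  have h0 : (∏ β, ((b β).factorial : ℂ)) ≠ 0 :=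
    Finset.prod_ne_zero_iff.mpr fun β _ => Nat.cast_ne_zero.mpr (Nat.factorial_ne_zero _)
  rw [taylorTerm, map_smul, equivMvPolynomial_zMonomial, MvPolynomial.smul_monomial, smul_eq_mul,
    mul_one, ← evalAt_zero_translate, ← iterDeriv_translate, ← coeff_zero_equivMvPolynomial z,
    coeff_zero_iterDeriv, inv_mul_cancel_left₀ h0]

theorem finsum_monomial_coeff (P : MvPolynomial (Fin n) ℂ) :
    ∑ᶠ b, MvPolynomial.monomial b (MvPolynomial.coeff b P) = P := by
  rw [finsum_eq_sum_of_support_subset (s := P.support)]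
  · exact P.support_sum_monomial_coeff
  · intro b hb
    simpa using hb

/-- The projection of `ℂ[V]` to the span of the `z^b` with `d · b = j`. -/
def gradedProj (d : Fin n → ℕ) (z : Basis (Fin n) ℂ (Dual ℂ V)) (j : ℕ) :
    Module.End ℂ (PolyAlg V) :=
  (SymmetricAlgebra.equivMvPolynomial z).symm.toLinearMap ∘ₗ
    MvPolynomial.weightedHomogeneousComponent d j ∘ₗ
      (SymmetricAlgebra.equivMvPolynomial z).toLinearMap

theorem equivMvPolynomial_gradedProj (d : Fin n → ℕ) (z : Basis (Fin n) ℂ (Dual ℂ V)) (j : ℕ)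
    (F : PolyAlg V) : SymmetricAlgebra.equivMvPolynomial z (gradedProj d z j F) =
      MvPolynomial.weightedHomogeneousComponent d j (SymmetricAlgebra.equivMvPolynomial z F) := by
  simp [gradedProj]

theorem weight_eq_dot (d : Fin n → ℕ) (b : Fin n →₀ ℕ) : Finsupp.weight d b = dot d b := by
  simp [Finsupp.weight_apply, Finsupp.sum_fintype, dot, mul_comm]

theorem equivMvPolynomial_finsum {ι : Sort*} (z : Basis (Fin n) ℂ (Dual ℂ V))
    (f : ι → PolyAlg V) : SymmetricAlgebra.equivMvPolynomial z (∑ᶠ i, f i) =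
      ∑ᶠ i, SymmetricAlgebra.equivMvPolynomial z (f i) :=
  AddEquiv.map_finsum (SymmetricAlgebra.equivMvPolynomial z).toRingEquiv.toAddEquiv f

theorem finsum_taylorTerm (z : Basis (Fin n) ℂ (Dual ℂ V)) (q : V) (F : PolyAlg V) :
    ∑ᶠ b : Fin n →₀ ℕ, taylorTerm z q F b = translate q F := by
  apply (SymmetricAlgebra.equivMvPolynomial z).injective
  rw [equivMvPolynomial_finsum]
  simp only [equivMvPolynomial_taylorTerm, finsum_monomial_coeff]

theorem finsum_taylorTerm_dot_eq (d : Fin n → ℕ) (z : Basis (Fin n) ℂ (Dual ℂ V)) (q : V)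
    (F : PolyAlg V) (j : ℕ) :
    ∑ᶠ (b : Fin n →₀ ℕ) (_ : dot d b = j), taylorTerm z q F b =
      gradedProj d z j (translate q F) := by
  apply (SymmetricAlgebra.equivMvPolynomial z).injective
  rw [equivMvPolynomial_gradedProj]
  set P := SymmetricAlgebra.equivMvPolynomial z (translate q F) with hP
  rw [← finsum_monomial_coeff (MvPolynomial.weightedHomogeneousComponent d j P),
    equivMvPolynomial_finsum]
  refine finsum_congr fun b => ?_
  rw [MvPolynomial.coeff_weightedHomogeneousComponent, weight_eq_dot]
  by_cases h : dot d b = j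
  · simp [h, equivMvPolynomial_taylorTerm, hP]
  · simp [h]

/-! ### The action of `GL(V)` -/

theorem dualAct_apply (h : V ≃ₗ[ℂ] V) (w : Dual ℂ V) (v : V) : dualAct h w v = w (h⁻¹ v) := rfl

theorem dualAct_mul (g h : V ≃ₗ[ℂ] V) (w : Dual ℂ V) :
    dualAct (g * h) w = dualAct g (dualAct h w) := rfl

theorem xi_mul (g h : V ≃ₗ[ℂ] V) (F : PolyAlg V) : xi (g * h) F = xi g (xi h F) := by
  have : (xi (g * h) : PolyAlg V →ₐ[ℂ] PolyAlg V) =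
      (xi g : PolyAlg V →ₐ[ℂ] PolyAlg V).comp (xi h) := by
    refine SymmetricAlgebra.algHom_ext (LinearMap.ext fun w => ?_)
    change xi (g * h) (incl V w) = xi g (xi h (incl V w))
    rw [xi_incl, xi_incl, xi_incl, dualAct_mul]
  exact DFunLike.congr_fun this F

theorem xi_one (F : PolyAlg V) : xi (1 : V ≃ₗ[ℂ] V) F = F := by
  have : (xi (1 : V ≃ₗ[ℂ] V) : PolyAlg V →ₐ[ℂ] PolyAlg V) = AlgHom.id ℂ _ := by
    refine SymmetricAlgebra.algHom_ext (LinearMap.ext fun w => ?_)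
    change xi (1 : V ≃ₗ[ℂ] V) (incl V w) = incl V w
    rw [xi_incl]
    rfl
  exact DFunLike.congr_fun this F

theorem evalAt_apply_xi (h : V ≃ₗ[ℂ] V) (F : PolyAlg V) (q : V) :
    evalAt (h q) (xi h F) = evalAt q F := by
  rw [evalAt_xi]
  exact congrArg (fun v => evalAt v F) (h.symm_apply_apply q)

theorem translate_xi (h : V ≃ₗ[ℂ] V) (q : V) (F : PolyAlg V) :
    translate (h q) (xi h F) = xi h (translate q F) := by
  have : (translate (h q)).comp (xi h : PolyAlg V →ₐ[ℂ] PolyAlg V) =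
      (xi h : PolyAlg V →ₐ[ℂ] PolyAlg V).comp (translate q) := by
    refine SymmetricAlgebra.algHom_ext (LinearMap.ext fun w => ?_)
    change translate (h q) (xi h (incl V w)) = xi h (translate q (incl V w))
    rw [xi_incl, translate_incl, translate_incl, map_add, xi_incl, AlgEquiv.commutes,
      dualAct_apply, ← LinearEquiv.mul_apply, inv_mul_cancel]
    rfl
  exact DFunLike.congr_fun this F

theorem xi_mem_linearForms (h : V ≃ₗ[ℂ] V) {F : PolyAlg V} (hF : F ∈ linearForms V) :
    xi h F ∈ linearForms V := by
  obtain ⟨w, rfl⟩ := hF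
  exact ⟨dualAct h w, (xi_incl h w).symm⟩

theorem xi_mem_linearForms_iff (h : V ≃ₗ[ℂ] V) {F : PolyAlg V} :
    xi h F ∈ linearForms V ↔ F ∈ linearForms V := by
  refine ⟨fun hF => ?_, xi_mem_linearForms h⟩
  have := xi_mem_linearForms h⁻¹ hF
  rwa [← xi_mul, inv_mul_cancel, xi_one] at this

theorem map_xi_linearForms (h : V ≃ₗ[ℂ] V) :
    (linearForms V).map (xi h).toLinearMap = linearForms V := by
  refine le_antisymm (Submodule.map_le_iff_le_comap.mpr fun F => xi_mem_linearForms h)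
    fun F hF => ⟨xi h⁻¹ F, xi_mem_linearForms _ hF, ?_⟩
  change xi h (xi h⁻¹ F) = F
  rw [← xi_mul, mul_inv_cancel, xi_one]

/-- An element of degree `k` is a sum of `k`-fold products of linear forms, each contributing one
factor `c`. Serves both the action of scalars and the values at multiples of `q`. -/
theorem algHom_eq_pow_smul {A : Type*} [CommRing A] [Algebra ℂ A] (θ η : PolyAlg V →ₐ[ℂ] A)
    (c : ℂ) (hθ : ∀ w, θ (incl V w) = c • η (incl V w)) (k : ℕ) {F : PolyAlg V}
    (hF : F ∈ degreePart V k) : θ F = c ^ k • η F := by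
  induction k generalizing F with
  | zero =>
    rw [degreePart, pow_zero] at hF
    obtain ⟨a, rfl⟩ := Submodule.mem_one.mp hF
    simp
  | succ k ih =>
    rw [degreePart, pow_succ] at hF
    induction hF using Submodule.mul_induction_on' with
    | mem_mul_mem A hA B hB =>
      obtain ⟨w, rfl⟩ := hB
      rw [map_mul, map_mul, ih hA, hθ, smul_mul_smul_comm, pow_succ]
    | add A _ B _ hA hB => rw [map_add, map_add, hA, hB, smul_add]

theorem dualAct_smulOfUnit (t : ℂˣ) (w : Dual ℂ V) :
    dualAct (LinearEquiv.smulOfUnit t : V ≃ₗ[ℂ] V) w = (t : ℂ)⁻¹ • w := by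
  ext v
  rw [dualAct_apply]
  have : (LinearEquiv.smulOfUnit t : V ≃ₗ[ℂ] V)⁻¹ v = (t : ℂ)⁻¹ • v := by
    change (LinearEquiv.smulOfUnit t : V ≃ₗ[ℂ] V).symm v = _
    rw [LinearEquiv.symm_apply_eq]
    change v = (t : ℂ) • _
    rw [smul_inv_smul₀ t.ne_zero]
  rw [this]
  simp

theorem xi_smulOfUnit (t : ℂˣ) {k : ℕ} {F : PolyAlg V} (hF : F ∈ degreePart V k) :
    xi (LinearEquiv.smulOfUnit t : V ≃ₗ[ℂ] V) F = (t : ℂ)⁻¹ ^ k • F :=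
  algHom_eq_pow_smul (xi (LinearEquiv.smulOfUnit t : V ≃ₗ[ℂ] V) : PolyAlg V →ₐ[ℂ] PolyAlg V)
    (AlgHom.id ℂ _) _ (fun w => by
      change xi _ (incl V w) = _
      rw [xi_incl, dualAct_smulOfUnit, map_smul]; rfl) k hF

theorem evalAt_smul (c : ℂ) (q : V) {k : ℕ} {F : PolyAlg V} (hF : F ∈ degreePart V k) :
    evalAt (c • q) F = c ^ k * evalAt q F :=
  algHom_eq_pow_smul (evalAt (c • q)) (evalAt q) c
    (fun w => by rw [evalAt_incl, evalAt_incl, map_smul]) k hF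

/-! ### Invariants -/

section invariants

variable {G : Subgroup (V ≃ₗ[ℂ] V)} {d : Fin n → ℕ}

theorem commute_smulOfUnit (t : ℂˣ) (g : V ≃ₗ[ℂ] V) :
    (LinearEquiv.smulOfUnit t : V ≃ₗ[ℂ] V) * g = g * LinearEquiv.smulOfUnit t :=
  LinearEquiv.ext fun v => (map_smul g (t : ℂ) v).symm

/-- The restriction of `ξ[h]` to the invariants, for `h` that preserves them. -/
def xiInvariants (h : V ≃ₗ[ℂ] V) (hinv : ∀ f ∈ invariants G, xi h f ∈ invariants G) :
    invariants G →ₐ[ℂ] invariants G :=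
  AlgHom.codRestrict ((xi h : PolyAlg V →ₐ[ℂ] PolyAlg V).comp (invariants G).val) _
    fun f => hinv f f.2

theorem coe_xiInvariants (h : V ≃ₗ[ℂ] V) (hinv : ∀ f ∈ invariants G, xi h f ∈ invariants G)
    (f : invariants G) : (xiInvariants h hinv f : PolyAlg V) = xi h f := rfl

theorem xi_mem_invariants {h : V ≃ₗ[ℂ] V} (hh : h ∈ G) :
    ∀ f ∈ invariants G, xi h f ∈ invariants G := fun f hf => by rwa [hf h hh]

theorem xi_smulOfUnit_mem_invariants (t : ℂˣ) : ∀ f ∈ invariants G,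
    xi (LinearEquiv.smulOfUnit t : V ≃ₗ[ℂ] V) f ∈ invariants G := fun f hf g hg => by
  rw [← xi_mul, ← commute_smulOfUnit, xi_mul, hf g hg]

/-- An invariant of degree `0` is a constant, hence algebraic, and cannot belong to an algebraically
independent family. -/
theorem degree_pos (x : BasicInvariants G d) (α : Fin n) : 0 < d α := by
  rw [Nat.pos_iff_ne_zero]
  intro h0
  have hx := x.homogeneous α
  rw [h0, degreePart, pow_zero] at hx
  obtain ⟨a, ha⟩ := Submodule.mem_one.mp hx
  refine x.algebraicIndependent.transcendental α ?_
  have : x.x α = algebraMap ℂ _ a := Subtype.ext ha.symm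
  rw [this]
  exact isAlgebraic_algebraMap a

theorem le_topDegree (d : Fin n → ℕ) (α : Fin n) : d α ≤ topDegree d :=
  Finset.le_sup (Finset.mem_univ α)

theorem xiInvariants_smulOfUnit_monomialBasis (x : BasicInvariants G d) (t : ℂˣ)
    (a : Fin n →₀ ℕ) :
    xiInvariants (LinearEquiv.smulOfUnit t) (xi_smulOfUnit_mem_invariants t)
      (x.monomialBasis a) = (t : ℂ)⁻¹ ^ dot d a • x.monomialBasis a := by
  have : ∀ α, xiInvariants (LinearEquiv.smulOfUnit t) (xi_smulOfUnit_mem_invariants t) (x.x α) =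
      (t : ℂ)⁻¹ ^ d α • x.x α := fun α => Subtype.ext (xi_smulOfUnit t (x.homogeneous α))
  simp only [x.monomialBasis_apply, map_prod, map_pow, this, smul_pow, dot,
    ← Finset.prod_pow_eq_pow_sum, pow_mul, Finset.prod_smul]

/-- Rescaling multiplies `f` by one power of the scalar and its `x^a`-coordinate by another; a
nonzero coordinate forces the two to agree. -/
theorem dot_eq_of_repr_ne_zero (x : BasicInvariants G d) {k : ℕ} {f : invariants G}
    (hf : (f : PolyAlg V) ∈ degreePart V k) {a : Fin n →₀ ℕ} (ha : x.monomialBasis.repr f a ≠ 0) :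
    dot d a = k := by
  -- With `t = 1/2` the factors are powers of `2`, whose exponents can be compared.
  set t : ℂˣ := Units.mk0 2⁻¹ (by norm_num) with ht
  set S := xiInvariants (G := G) (LinearEquiv.smulOfUnit t) (xi_smulOfUnit_mem_invariants t)
  have h1 : x.monomialBasis.repr (S f) a = (t : ℂ)⁻¹ ^ dot d a * x.monomialBasis.repr f a := by
    have : Finsupp.lapply a ∘ₗ x.monomialBasis.repr.toLinearMap ∘ₗ S.toLinearMap =
        (t : ℂ)⁻¹ ^ dot d a • (Finsupp.lapply a ∘ₗ x.monomialBasis.repr.toLinearMap) := by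
      refine x.monomialBasis.ext fun c => ?_
      simp only [LinearMap.comp_apply, AlgHom.toLinearMap_apply, S,
        xiInvariants_smulOfUnit_monomialBasis, LinearEquiv.coe_coe, map_smul, Basis.repr_self,
        Finsupp.lapply_apply, LinearMap.smul_apply, Finsupp.single_apply]
      by_cases hca : c = a
      · simp [hca]
      · simp [hca]
    exact DFunLike.congr_fun this f
  have h2 : S f = (t : ℂ)⁻¹ ^ k • f := Subtype.ext (xi_smulOfUnit t hf)
  rw [h2, map_smul, Finsupp.smul_apply, smul_eq_mul] at h1
  have h3 := mul_right_cancel₀ ha h1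
  simp only [ht, Units.val_mk0, inv_inv] at h3
  exact (Nat.pow_right_injective le_rfl (by exact_mod_cast h3 : 2 ^ k = 2 ^ dot d a)).symm

/-! ### The morphisms `φ` and `ψ` -/

/-- `φ[g, ζ, q]` as a morphism of algebras. -/
def phiHom (x : BasicInvariants G d) (q : V) : invariants G →ₐ[ℂ] PolyAlg V :=
  (MvPolynomial.aeval fun α =>
      translate q (x.x α) - algebraMap ℂ (PolyAlg V) (evalAt q (x.x α))).comp
    (AlgEquiv.ofBijective (MvPolynomial.aeval (R := ℂ) x.x) x.aeval_bijective).symm.toAlgHom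

theorem phiHom_x (x : BasicInvariants G d) (q : V) (α : Fin n) :
    phiHom x q (x.x α) = translate q (x.x α) - algebraMap ℂ (PolyAlg V) (evalAt q (x.x α)) := by
  have : (AlgEquiv.ofBijective (MvPolynomial.aeval (R := ℂ) x.x) x.aeval_bijective).symm (x.x α) =
      MvPolynomial.X α := by
    rw [AlgEquiv.symm_apply_eq]
    simp
  change MvPolynomial.aeval _ ((AlgEquiv.ofBijective _ x.aeval_bijective).symm (x.x α)) = _
  rw [this, MvPolynomial.aeval_X]

theorem phiHom_monomialBasis (x : BasicInvariants G d) (q : V) (a : Fin n →₀ ℕ) :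
    phiHom x q (x.monomialBasis a) = translate q (x.shiftedMonomial q a) := by
  simp only [x.monomialBasis_apply, map_prod, map_pow, phiHom_x, BasicInvariants.shiftedMonomial,
    map_sub, AlgHom.commutes]

theorem phi_eq_phiHom (x : BasicInvariants G d) (z : Basis (Fin n) ℂ (Dual ℂ V)) (q : V) :
    phi x z q = (phiHom x q).toLinearMap := by
  refine x.monomialBasis.ext fun a => ?_
  rw [phi, Basis.constr_basis, finsum_taylorTerm, AlgHom.toLinearMap_apply, phiHom_monomialBasis]

theorem psi_monomialBasis (x : BasicInvariants G d) (z : Basis (Fin n) ℂ (Dual ℂ V)) (q : V)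
    (a : Fin n →₀ ℕ) :
    psi x z q (x.monomialBasis a) = gradedProj d z (dot d a) (phiHom x q (x.monomialBasis a)) := by
  rw [psi, Basis.constr_basis, finsum_taylorTerm_dot_eq, phiHom_monomialBasis]

/-- The cut-off `d · a` in `psi` refers to the monomials in `x`; here it becomes the polynomial
degree, which makes sense for any set of basic invariants. -/
theorem psi_eq_gradedProj (x : BasicInvariants G d) (z : Basis (Fin n) ℂ (Dual ℂ V)) (q : V)
    {k : ℕ} {f : invariants G} (hf : (f : PolyAlg V) ∈ degreePart V k) :
    psi x z q f = gradedProj d z k (phiHom x q f) := by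
  have h := x.monomialBasis.linearCombination_repr f
  rw [← h, Finsupp.linearCombination_apply, Finsupp.sum, map_sum, map_sum, map_sum]
  refine Finset.sum_congr rfl fun a ha => ?_
  rw [map_smul, map_smul, map_smul, psi_monomialBasis,
    dot_eq_of_repr_ne_zero x hf (Finsupp.mem_support_iff.mp ha)]

theorem monomialBasis_mem_degreePart (x : BasicInvariants G d) (a : Fin n →₀ ℕ) :
    (x.monomialBasis a : PolyAlg V) ∈ degreePart V (dot d a) := by
  rw [x.monomialBasis_apply, SubmonoidClass.coe_finsetProd, degreePart, dot]
  induction (Finset.univ : Finset (Fin n)) using Finset.induction_on with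
  | empty => simp
  | insert α s hα ih =>
    rw [Finset.prod_insert hα, Finset.sum_insert hα, pow_add, SubmonoidClass.coe_pow, pow_mul]
    exact Submodule.mul_mem_mul (Submodule.pow_mem_pow _ (x.homogeneous α) _) ih

end invariants

/-! ### Admissible triplets -/

section admissible

variable [FiniteDimensional ℂ V] {G : Subgroup (V ≃ₗ[ℂ] V)} {d : Fin n → ℕ} {g : V ≃ₗ[ℂ] V}
  {ζ : ℂ} {q : V}

/-- Invariance under `g` and homogeneity give `ζ^{d_α} x^α(q) = x^α(q)`, and `ζ^{d_α} ≠ 1` for `0 <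
d_α < d_n`. -/
theorem IsAdmissible.evalAt_eq_zero (hadm : IsAdmissible G d g ζ q) (x : BasicInvariants G d)
    {α : Fin n} (hα : d α ≠ topDegree d) : evalAt q (x.x α : PolyAlg V) = 0 := by
  have h1 : g q = ζ • q := hadm.eigenvector.apply_eq_smul
  have h2 := evalAt_apply_xi g (x.x α : PolyAlg V) q
  rw [(x.x α).2 g hadm.mem, h1, evalAt_smul ζ q (x.homogeneous α)] at h2
  by_contra h0
  have h3 : ζ ^ d α = 1 := by
    rwa [mul_eq_right₀ h0] at h2
  exact hα (le_antisymm (le_topDegree d α)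
    (Nat.le_of_dvd (degree_pos x α) (hadm.primitive.dvd_of_pow_eq_one _ h3)))

/-- The eigenvector `q` is nonzero, so `V*` is nonzero and some degree occurs. -/
theorem IsAdmissible.topDegree_pos (hadm : IsAdmissible G d g ζ q) : 0 < topDegree d := by
  obtain ⟨x, z, -⟩ := hadm.jacobian_invertible
  have : Nonempty (Fin n) := by
    by_contra hn
    rw [not_nonempty_iff] at hn
    have : Subsingleton (Dual ℂ V) := z.repr.toEquiv.subsingleton
    exact hadm.eigenvector.2 ((Module.forall_dual_apply_eq_zero_iff ℂ q).mp fun f => by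
      rw [Subsingleton.elim f 0]; rfl)
  exact (degree_pos x this.some).trans_le (le_topDegree d _)

/-- A monomial of degree at most `d_n` either is a single generator of top degree, or contains only
generators vanishing at `q`, which the shift leaves unchanged. Positivity excludes the monomial `1`,
for which the two sides are `1` and `0`. -/
theorem IsAdmissible.shiftedMonomial_eq (hadm : IsAdmissible G d g ζ q) (x : BasicInvariants G d)
    {a : Fin n →₀ ℕ} (h0 : 0 < dot d a) (h1 : dot d a ≤ topDegree d) :
    x.shiftedMonomial q a = x.monomialBasis a -
      algebraMap ℂ (PolyAlg V) (evalAt q (x.monomialBasis a : PolyAlg V)) := by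
  rw [x.monomialBasis_apply, SubmonoidClass.coe_finsetProd]
  simp only [SubmonoidClass.coe_pow]
  by_cases h : ∃ α, a α ≠ 0 ∧ d α = topDegree d
  · obtain ⟨α, hα, hd⟩ := h
    have key : d α * a α + ∑ β ∈ Finset.univ.erase α, d β * a β = dot d a :=
      Finset.add_sum_erase _ (fun β => d β * a β) (Finset.mem_univ α)
    have hpos := hadm.topDegree_pos
    rw [hd] at key
    have h2 : a α = 1 := by
      -- The term of `α` alone already exhausts the bound `d_n`.
      have : topDegree d * a α ≤ topDegree d * 1 := by omega
      have := Nat.le_of_mul_le_mul_left this hpos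
      omega
    have h3 : ∑ β ∈ Finset.univ.erase α, d β * a β = 0 := by
      rw [h2] at key
      omega
    have h4 : ∀ β, β ≠ α → a β = 0 := fun β hβ => by
      have := (Finset.sum_eq_zero_iff.mp h3) β (Finset.mem_erase.mpr ⟨hβ, Finset.mem_univ _⟩)
      exact (Nat.mul_eq_zero.mp this).resolve_left (degree_pos x β).ne'
    rw [BasicInvariants.shiftedMonomial,
      Fintype.prod_eq_single α fun β hβ => by rw [h4 β hβ, pow_zero],
      Fintype.prod_eq_single α fun β hβ => by rw [h4 β hβ, pow_zero], h2, pow_one, pow_one]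
  · push Not at h
    have hne : ∃ α, a α ≠ 0 := by
      by_contra! hall
      simp [dot, hall] at h0
    obtain ⟨α, hα⟩ := hne
    have h2 : evalAt q (∏ β, (x.x β : PolyAlg V) ^ a β) = 0 := by
      rw [map_prod]
      refine Finset.prod_eq_zero (Finset.mem_univ α) ?_
      rw [map_pow, hadm.evalAt_eq_zero x (h α hα), zero_pow hα]
    rw [h2, map_zero, sub_zero, BasicInvariants.shiftedMonomial]
    refine Finset.prod_congr rfl fun β _ => ?_
    by_cases hβ : a β = 0
    · rw [hβ, pow_zero, pow_zero]
    · rw [hadm.evalAt_eq_zero x (h β hβ), map_zero, sub_zero]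

/-- The right side does not mention `x`. This is why `phi` is independent of the basic invariants:
their members all have degrees in this range. -/
theorem IsAdmissible.phiHom_apply (hadm : IsAdmissible G d g ζ q) (x : BasicInvariants G d)
    {k : ℕ} (h0 : 0 < k) (h1 : k ≤ topDegree d) {f : invariants G}
    (hf : (f : PolyAlg V) ∈ degreePart V k) :
    phiHom x q f = translate q f - algebraMap ℂ (PolyAlg V) (evalAt q (f : PolyAlg V)) := by
  have h := x.monomialBasis.linearCombination_repr f
  let L : invariants G →ₗ[ℂ] PolyAlg V :=
    (translate q).toLinearMap ∘ₗ (invariants G).val.toLinearMap -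
    Algebra.linearMap ℂ (PolyAlg V) ∘ₗ (evalAt q).toLinearMap ∘ₗ (invariants G).val.toLinearMap
  change phiHom x q f = L f
  rw [← h, Finsupp.linearCombination_apply, Finsupp.sum, map_sum, map_sum]
  refine Finset.sum_congr rfl fun a ha => ?_
  have hk := dot_eq_of_repr_ne_zero x hf (Finsupp.mem_support_iff.mp ha)
  rw [map_smul, map_smul, phiHom_monomialBasis, hadm.shiftedMonomial_eq x (hk ▸ h0) (hk ▸ h1),
    map_sub, AlgHom.commutes]
  rfl

end admissible

/-! ### The grading by `d` -/

section grading

variable {d : Fin n → ℕ} {z z' : Basis (Fin n) ℂ (Dual ℂ V)} {h : V ≃ₗ[ℂ] V}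

theorem mem_gradedPart_iff {j : ℕ} {F : PolyAlg V} : F ∈ gradedPart d z j ↔
    MvPolynomial.IsWeightedHomogeneous d (SymmetricAlgebra.equivMvPolynomial z F) j := by
  constructor
  · intro hF
    have : gradedPart d z j ≤ (MvPolynomial.weightedHomogeneousSubmodule ℂ d j).comap
        (SymmetricAlgebra.equivMvPolynomial z).toLinearMap := by
      refine Submodule.span_le.mpr ?_
      rintro _ ⟨b, hb, rfl⟩
      change MvPolynomial.IsWeightedHomogeneous d
        (SymmetricAlgebra.equivMvPolynomial z (zMonomial z b)) j
      rw [equivMvPolynomial_zMonomial]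
      exact MvPolynomial.isWeightedHomogeneous_monomial _ _ _ (by rw [weight_eq_dot, hb])
    exact this hF
  · intro hF
    have : F = ∑ b ∈ (SymmetricAlgebra.equivMvPolynomial z F).support,
        MvPolynomial.coeff b (SymmetricAlgebra.equivMvPolynomial z F) • zMonomial z b := by
      apply (SymmetricAlgebra.equivMvPolynomial z).injective
      simp only [map_sum, map_smul, equivMvPolynomial_zMonomial, MvPolynomial.smul_monomial,
        smul_eq_mul, mul_one, MvPolynomial.support_sum_monomial_coeff]
    rw [this]
    refine Submodule.sum_mem _ fun b hb => Submodule.smul_mem _ _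
      (Submodule.subset_span ⟨b, ?_, rfl⟩)
    rw [← weight_eq_dot]
    exact hF (MvPolynomial.mem_support_iff.mp hb)

theorem gradedProj_mem (j : ℕ) (F : PolyAlg V) : gradedProj d z j F ∈ gradedPart d z j := by
  rw [mem_gradedPart_iff, equivMvPolynomial_gradedProj]
  exact MvPolynomial.weightedHomogeneousComponent_isWeightedHomogeneous _ _

theorem gradedProj_of_mem {i : ℕ} (j : ℕ) {F : PolyAlg V} (hF : F ∈ gradedPart d z i) :
    gradedProj d z j F = if j = i then F else 0 := by
  apply (SymmetricAlgebra.equivMvPolynomial z).injective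
  rw [equivMvPolynomial_gradedProj,
    MvPolynomial.weightedHomogeneousComponent_of_mem (mem_gradedPart_iff.mp hF)]
  split_ifs <;> simp

theorem zMonomial_mem_gradedPart (b : Fin n →₀ ℕ) : zMonomial z b ∈ gradedPart d z (dot d b) :=
  Submodule.subset_span ⟨b, rfl, rfl⟩

theorem incl_mem_gradedPart (α : Fin n) : incl V (z α) ∈ gradedPart d z (d α) := by
  rw [mem_gradedPart_iff, SymmetricAlgebra.equivMvPolynomial_ι_apply]
  exact MvPolynomial.isWeightedHomogeneous_X _ _ _

theorem prod_pow_mem_gradedPart {F : Fin n → PolyAlg V} (hF : ∀ α, F α ∈ gradedPart d z (d α))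
    (b : Fin n →₀ ℕ) : ∏ α, F α ^ b α ∈ gradedPart d z (dot d b) := by
  rw [mem_gradedPart_iff, map_prod]
  refine MvPolynomial.IsWeightedHomogeneous.prod _ _ (fun α => d α * b α) fun α _ => ?_
  rw [map_pow, mul_comm]
  exact (mem_gradedPart_iff.mp (hF α)).pow _

theorem xi_mem_gradedPart (hh : ∀ β, incl V (dualAct h (z β)) ∈ gradedPart d z' (d β)) {j : ℕ}
    {F : PolyAlg V} (hF : F ∈ gradedPart d z j) : xi h F ∈ gradedPart d z' j := by
  have : gradedPart d z j ≤ (gradedPart d z' j).comap (xi h).toLinearMap := by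
    refine Submodule.span_le.mpr ?_
    rintro _ ⟨b, rfl, rfl⟩
    change xi h (zMonomial z b) ∈ gradedPart d z' (dot d b)
    simp only [zMonomial, map_prod, map_pow, xi_incl]
    exact prod_pow_mem_gradedPart hh b
  exact this hF

/-- The monomials `z^b` span `ℂ[V]` and `ξ[h]` preserves their weights, so it commutes with the
projections. -/
theorem gradedProj_xi (hh : ∀ β, incl V (dualAct h (z β)) ∈ gradedPart d z' (d β)) (j : ℕ)
    (F : PolyAlg V) : gradedProj d z' j (xi h F) = xi h (gradedProj d z j F) := by
  suffices gradedProj d z' j ∘ₗ (xi h).toLinearMap = (xi h).toLinearMap ∘ₗ gradedProj d z j from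
    DFunLike.congr_fun this F
  refine (Basis.symmetricAlgebra z).ext fun b => ?_
  have hb : Basis.symmetricAlgebra z b = zMonomial z b := by
    apply (SymmetricAlgebra.equivMvPolynomial z).injective
    rw [equivMvPolynomial_zMonomial]
    simp [Basis.symmetricAlgebra]
  change gradedProj d z' j (xi h _) = xi h (gradedProj d z j _)
  rw [hb, gradedProj_of_mem j (xi_mem_gradedPart hh (zMonomial_mem_gradedPart b)),
    gradedProj_of_mem j (zMonomial_mem_gradedPart b)]
  split_ifs <;> simp

/-- The algebra endomorphism of `ℂ[V]` that multiplies `V(g, ζ, q)(j)` by `c ^ j`. -/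
def gradedScale (d : Fin n → ℕ) (z : Basis (Fin n) ℂ (Dual ℂ V)) (c : ℂ) :
    PolyAlg V →ₐ[ℂ] PolyAlg V :=
  SymmetricAlgebra.lift (incl V ∘ₗ z.constr ℂ fun α => c ^ d α • z α)

theorem gradedScale_mem_linearForms (c : ℂ) {F : PolyAlg V} (hF : F ∈ linearForms V) :
    gradedScale d z c F ∈ linearForms V := by
  obtain ⟨w, rfl⟩ := hF
  rw [gradedScale, SymmetricAlgebra.lift_ι_apply]
  exact ⟨_, rfl⟩

theorem gradedScale_of_mem (c : ℂ) {j : ℕ} {F : PolyAlg V} (hF : F ∈ gradedPart d z j) :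
    gradedScale d z c F = c ^ j • F := by
  have : gradedPart d z j ≤ LinearMap.eqLocus (gradedScale d z c).toLinearMap
      (c ^ j • LinearMap.id) := by
    refine Submodule.span_le.mpr ?_
    rintro _ ⟨b, rfl, rfl⟩
    have hz : ∀ α, gradedScale d z c (incl V (z α)) = c ^ d α • incl V (z α) := fun α => by
      rw [gradedScale, SymmetricAlgebra.lift_ι_apply, LinearMap.comp_apply, Basis.constr_basis,
        map_smul]
    change gradedScale d z c (zMonomial z b) = c ^ dot d b • zMonomial z b
    simp only [zMonomial, map_prod, map_pow, hz, smul_pow, dot, ← Finset.prod_pow_eq_pow_sum,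
      pow_mul, Finset.prod_smul]
  exact this hF

end grading

/-! ### Adapted bases -/

section adapted

variable {d : Fin n → ℕ} {g g' h : V ≃ₗ[ℂ] V} {ζ : ℂ} {q : V}
  {z z' : Basis (Fin n) ℂ (Dual ℂ V)}

/-- The exponents `d_α - 1` lie in `[0, d_n - 1]`, where the powers of a primitive `d_n`-th root are
distinct. -/
theorem IsPrimitiveRoot.degree_eq (hζ : IsPrimitiveRoot ζ (topDegree d)) {α β : Fin n}
    (hα : 0 < d α) (hβ : 0 < d β) (he : ζ ^ ((d α : ℤ) - 1) = ζ ^ ((d β : ℤ) - 1)) :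
    d α = d β := by
  have h1 := le_topDegree d α
  have h2 := le_topDegree d β
  have h3 : ((d α : ℤ) - 1) = ((d α - 1 : ℕ) : ℤ) := by omega
  have h4 : ((d β : ℤ) - 1) = ((d β - 1 : ℕ) : ℤ) := by omega
  rw [h3, h4, zpow_natCast, zpow_natCast] at he
  have := hζ.pow_inj (by omega) (by omega) he
  omega

/-- The form `h · z^β` is an eigenvector of `g'` for `ζ^{d_β - 1}`, so only those `z'^γ` with `d_γ =
d_β` occur in it. -/
theorem IsAdapted.incl_dualAct_mem (hz : IsAdapted d g ζ z) (hz' : IsAdapted d g' ζ z')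
    (hζ : IsPrimitiveRoot ζ (topDegree d)) (hd : ∀ α, 0 < d α) (hh : h * g = g' * h) (β : Fin n) :
    incl V (dualAct h (z β)) ∈ gradedPart d z' (d β) := by
  set w := dualAct h (z β) with hw
  have h1 : dualAct g' w = ζ ^ ((d β : ℤ) - 1) • w := by
    rw [hw, ← dualAct_mul, ← hh, dualAct_mul, hz β, map_smul]
  have h2 : ∀ γ, z'.repr (dualAct g' w) γ = ζ ^ ((d γ : ℤ) - 1) * z'.repr w γ := by
    intro γ
    have : z'.coord γ ∘ₗ (dualAct g').toLinearMap = ζ ^ ((d γ : ℤ) - 1) • z'.coord γ := by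
      refine z'.ext fun δ => ?_
      simp only [LinearMap.comp_apply, LinearEquiv.coe_coe, hz' δ, map_smul, Basis.coord_apply,
        Basis.repr_self, LinearMap.smul_apply, Finsupp.single_apply]
      by_cases hδ : δ = γ
      · simp [hδ]
      · simp [hδ]
    exact DFunLike.congr_fun this w
  rw [← z'.sum_repr w, map_sum]
  refine Submodule.sum_mem _ fun γ _ => ?_
  rw [map_smul]
  by_cases h0 : z'.repr w γ = 0
  · rw [h0, zero_smul]
    exact Submodule.zero_mem _
  · have h3 := h2 γ
    rw [h1, map_smul, Finsupp.smul_apply, smul_eq_mul] at h3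
    rw [← IsPrimitiveRoot.degree_eq hζ (hd γ) (hd β) (mul_right_cancel₀ h0 h3).symm]
    exact Submodule.smul_mem _ _ (incl_mem_gradedPart γ)

theorem IsAdapted.map_gradedPart (hz : IsAdapted d g ζ z) (hz' : IsAdapted d g' ζ z')
    (hζ : IsPrimitiveRoot ζ (topDegree d)) (hd : ∀ α, 0 < d α) (hh : h * g = g' * h) (j : ℕ) :
    (gradedPart d z j).map (xi h).toLinearMap = gradedPart d z' j := by
  have hh' : h⁻¹ * g' = g * h⁻¹ := by
    rw [inv_mul_eq_iff_eq_mul, ← mul_assoc, hh, mul_inv_cancel_right]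
  refine le_antisymm (Submodule.map_le_iff_le_comap.mpr fun F =>
    xi_mem_gradedPart (hz.incl_dualAct_mem hz' hζ hd hh)) fun F hF =>
    ⟨xi h⁻¹ F, xi_mem_gradedPart (hz'.incl_dualAct_mem hz hζ hd hh') hF, ?_⟩
  change xi h (xi h⁻¹ F) = F
  rw [← xi_mul, mul_inv_cancel, xi_one]

end adapted

/-! ### Equivariance of the morphisms -/

section equivariance

variable [FiniteDimensional ℂ V] {G : Subgroup (V ≃ₗ[ℂ] V)} {d : Fin n → ℕ} {g g' h : V ≃ₗ[ℂ] V}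
  {ζ : ℂ} {q : V} {z z' : Basis (Fin n) ℂ (Dual ℂ V)} {c : Fin n → ℂ}

theorem IsAdmissible.degree_pos (hadm : IsAdmissible G d g ζ q) (α : Fin n) : 0 < d α := by
  obtain ⟨x, -⟩ := hadm.jacobian_invertible
  exact GoodInv.degree_pos x α

/-- Both sides are algebra morphisms, so generators suffice. The scalars `c α` treat `h ∈ G` and `h
= t id` together, and keep `ξ[h] x^α` in degree `d_α`, where `φ` has the formula free of `x'`. -/
theorem IsAdmissible.phiHom_xi (hadm : IsAdmissible G d g ζ q)
    (hadm' : IsAdmissible G d g' ζ (h q)) (hinv : ∀ f ∈ invariants G, xi h f ∈ invariants G)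
    (x x' : BasicInvariants G d) (hc : ∀ α, xi h (x.x α) = c α • (x.x α : PolyAlg V))
    (f : invariants G) :
    phiHom x' (h q) (xiInvariants h hinv f) = xi h (phiHom x q f) := by
  have : (phiHom x' (h q)).comp (xiInvariants h hinv) =
      (xi h : PolyAlg V →ₐ[ℂ] PolyAlg V).comp (phiHom x q) := by
    refine AlgHom.ext_of_adjoin_eq_top x.adjoin_eq_top ?_
    rintro _ ⟨α, rfl⟩
    have hK : (xiInvariants h hinv (x.x α) : PolyAlg V) ∈ degreePart V (d α) := by
      rw [coe_xiInvariants, hc]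
      exact Submodule.smul_mem _ _ (x.homogeneous α)
    change phiHom x' (h q) (xiInvariants h hinv (x.x α)) = xi h (phiHom x q (x.x α))
    rw [hadm'.phiHom_apply x' (hadm.degree_pos α) (le_topDegree d α) hK, phiHom_x, map_sub,
      coe_xiInvariants, translate_xi, evalAt_apply_xi, AlgEquiv.commutes]
  exact DFunLike.congr_fun this f

theorem IsAdmissible.psi_xi (hadm : IsAdmissible G d g ζ q)
    (hadm' : IsAdmissible G d g' ζ (h q)) (hinv : ∀ f ∈ invariants G, xi h f ∈ invariants G)
    (hh : h * g = g' * h) (hz : IsAdapted d g ζ z) (hz' : IsAdapted d g' ζ z')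
    (x x' : BasicInvariants G d) (hc : ∀ α, xi h (x.x α) = c α • (x.x α : PolyAlg V))
    (f : invariants G) :
    psi x' z' (h q) (xiInvariants h hinv f) = xi h (psi x z q f) := by
  have : psi x' z' (h q) ∘ₗ (xiInvariants h hinv).toLinearMap =
      (xi h).toLinearMap ∘ₗ psi x z q := by
    refine x.monomialBasis.ext fun a => ?_
    have hm := monomialBasis_mem_degreePart x a
    have hK : (xiInvariants h hinv (x.monomialBasis a) : PolyAlg V) ∈
        degreePart V (dot d a) := by
      have : xiInvariants h hinv (x.monomialBasis a) = (∏ α, c α ^ a α) • x.monomialBasis a := by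
        have hx : ∀ α, xiInvariants h hinv (x.x α) = c α • x.x α := fun α => Subtype.ext (hc α)
        simp only [x.monomialBasis_apply, map_prod, map_pow, hx, smul_pow, Finset.prod_smul]
      rw [this]
      exact Submodule.smul_mem _ _ hm
    change psi x' z' (h q) (xiInvariants h hinv (x.monomialBasis a)) =
      xi h (psi x z q (x.monomialBasis a))
    rw [psi_eq_gradedProj _ _ _ hK, psi_monomialBasis,
      hadm.phiHom_xi hadm' hinv x x' hc,
      gradedProj_xi (hz.incl_dualAct_mem hz' hadm.primitive hadm.degree_pos hh)]
  exact DFunLike.congr_fun this f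

/-- `φ` and `ψ` do not depend on the adapted basis and the basic invariants. -/
theorem IsAdmissible.independence (hadm : IsAdmissible G d g ζ q) (hz : IsAdapted d g ζ z)
    (hz' : IsAdapted d g ζ z') :
    (∀ j, gradedPart d z j = gradedPart d z' j) ∧ ∀ x x' : BasicInvariants G d,
      phi x z q = phi x' z' q ∧ psi x z q = psi x' z' q := by
  have hinv := xi_mem_invariants G.one_mem
  have hh : (1 : V ≃ₗ[ℂ] V) * g = g * 1 := by rw [one_mul, mul_one]
  have hK : ∀ f, xiInvariants 1 hinv f = f := fun f => Subtype.ext (xi_one _)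
  refine ⟨fun j => ?_, fun x x' => ?_⟩
  · rw [← hz.map_gradedPart hz' hadm.primitive hadm.degree_pos hh j]
    have : (xi (1 : V ≃ₗ[ℂ] V)).toLinearMap = LinearMap.id := LinearMap.ext xi_one
    rw [this, Submodule.map_id]
  · have hc : ∀ α, xi (1 : V ≃ₗ[ℂ] V) (x.x α) = (1 : ℂ) • (x.x α : PolyAlg V) := fun α => by
      rw [xi_one, one_smul]
    refine ⟨?_, LinearMap.ext fun f => ?_⟩
    · rw [phi_eq_phiHom, phi_eq_phiHom]
      refine LinearMap.ext fun f => ?_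
      have := hadm.phiHom_xi (h := 1) (c := fun _ => 1) hadm hinv x x' hc f
      rw [hK, xi_one] at this
      exact this.symm
    · have := hadm.psi_xi (h := 1) (c := fun _ => 1) hadm hinv hh hz hz' x x' hc f
      rw [hK, xi_one] at this
      exact this.symm

end equivariance

/-! ### Eigenbases -/

/-- Both families have the same multiset of roots, so their fibres over each value have equal size
and can be matched. -/
theorem exists_equiv_of_prod_X_sub_C_eq {ι : Type*} [Fintype ι] {μ ν : ι → ℂ}
    (h : ∏ i, (Polynomial.X - Polynomial.C (μ i)) = ∏ i, (Polynomial.X - Polynomial.C (ν i))) :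
    ∃ σ : ι ≃ ι, ∀ i, ν (σ i) = μ i := by
  classical
  have hroots : ∀ τ : ι → ℂ, (∏ i, (Polynomial.X - Polynomial.C (τ i))).roots =
      Finset.univ.val.map τ := fun τ => by
    rw [← Polynomial.roots_multiset_prod_X_sub_C (Finset.univ.val.map τ), Multiset.map_map]
    rfl
  have hm : Finset.univ.val.map μ = Finset.univ.val.map ν := by rw [← hroots, ← hroots, h]
  have hcard : ∀ c, Fintype.card {i // μ i = c} = Fintype.card {i // ν i = c} := fun c => by
    have := congrArg (Multiset.count c) hm
    rw [Multiset.count_map, Multiset.count_map] at this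
    simp only [Fintype.card_subtype, eq_comm (b := c)]
    exact this
  exact ⟨Equiv.ofFiberEquiv fun c => Fintype.equivOfCardEq (hcard c),
    fun i => Equiv.ofFiberEquiv_map _ i⟩

/-- `X^m - 1` is squarefree over `ℂ`, so `f` is semisimple and `V` is the direct sum of its
eigenspaces. -/
theorem exists_eigenbasis_of_pow_eq_one [FiniteDimensional ℂ V] (hn : finrank ℂ V = n)
    (f : End ℂ V) {m : ℕ} (hm : m ≠ 0) (hf : f ^ m = 1) :
    ∃ (b : Basis (Fin n) ℂ V) (μ : Fin n → ℂ), ∀ i, f (b i) = μ i • b i := by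
  classical
  have hs : f.IsSemisimple := by
    refine End.isSemisimple_of_squarefree_aeval_eq_zero (p := Polynomial.X ^ m - Polynomial.C 1)
      (Polynomial.separable_X_pow_sub_C (1 : ℂ) (Nat.cast_ne_zero.mpr hm) one_ne_zero).squarefree ?_
    simp [hf]
  have hint : DirectSum.IsInternal fun μ : ℂ => f.eigenspace μ :=
    DirectSum.isInternal_submodule_of_iSupIndep_of_iSup_eq_top f.eigenspaces_iSupIndep
      hs.iSup_eigenspace_eq_top
  let B := hint.collectedBasis fun μ => finBasis ℂ (f.eigenspace μ)
  let e := B.indexEquiv (finBasisOfFinrankEq ℂ V hn)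
  refine ⟨B.reindex e, fun i => (e.symm i).1, fun i => ?_⟩
  rw [Basis.reindex_apply]
  exact End.mem_eigenspace_iff.mp (hint.collectedBasis_mem _ _)

theorem charpoly_eq_of_eigenbasis {f : End ℂ V} (b : Basis (Fin n) ℂ V) {μ : Fin n → ℂ}
    (hb : ∀ i, f (b i) = μ i • b i) [FiniteDimensional ℂ V] :
    f.charpoly = ∏ i, (Polynomial.X - Polynomial.C (μ i)) := by
  have : LinearMap.toMatrix b b f = Matrix.diagonal μ := by
    ext i j
    rw [LinearMap.toMatrix_apply, hb, map_smul, Finsupp.smul_apply, Basis.repr_self,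
      Finsupp.single_apply, Matrix.diagonal_apply]
    by_cases h : i = j
    · simp [h]
    · simp [h, Ne.symm h]
  rw [← f.charpoly_toMatrix b, this, Matrix.charpoly_diagonal]

theorem inv_apply_of_eigenvector {g : V ≃ₗ[ℂ] V} {c : ℂ} (hc : c ≠ 0) {v : V}
    (h : g v = c • v) : g⁻¹ v = c⁻¹ • v := by
  change g.symm v = _
  rw [LinearEquiv.symm_apply_eq, map_smul, h, inv_smul_smul₀ hc]

theorem zpow_apply_of_eigenvector {g : V ≃ₗ[ℂ] V} {c : ℂ} (hc : c ≠ 0) {v : V}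
    (h : g v = c • v) (r : ℤ) : (g ^ r) v = c ^ r • v := by
  have hnat : ∀ k : ℕ, (g ^ k) v = c ^ k • v := fun k => by
    induction k with
    | zero => simp
    | succ k ih => rw [pow_succ, LinearEquiv.mul_apply, h, map_smul, ih, smul_smul, pow_succ']
  cases r with
  | ofNat k => simpa using hnat k
  | negSucc k =>
    rw [zpow_negSucc, zpow_negSucc]
    exact inv_apply_of_eigenvector (pow_ne_zero _ hc) (hnat _)

/-! ### Equivariance of the Jacobian matrix and of the good space -/

section equivariance

variable {G : Subgroup (V ≃ₗ[ℂ] V)} {d : Fin n → ℕ} {h : V ≃ₗ[ℂ] V} {q : V}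

theorem equivMvPolynomial_map_xi (z : Basis (Fin n) ℂ (Dual ℂ V)) (h : V ≃ₗ[ℂ] V)
    (F : PolyAlg V) : SymmetricAlgebra.equivMvPolynomial (z.map (dualAct h)) (xi h F) =
      SymmetricAlgebra.equivMvPolynomial z F := by
  have : (SymmetricAlgebra.equivMvPolynomial (z.map (dualAct h)) :
      PolyAlg V →ₐ[ℂ] MvPolynomial (Fin n) ℂ).comp
      (xi h : PolyAlg V →ₐ[ℂ] PolyAlg V) =
      (SymmetricAlgebra.equivMvPolynomial z : PolyAlg V →ₐ[ℂ] MvPolynomial (Fin n) ℂ) := by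
    refine SymmetricAlgebra.algHom_ext (z.ext fun i => ?_)
    change SymmetricAlgebra.equivMvPolynomial (z.map (dualAct h)) (xi h (incl V (z i))) =
      SymmetricAlgebra.equivMvPolynomial z (incl V (z i))
    rw [xi_incl, SymmetricAlgebra.equivMvPolynomial_ι_apply, ← Basis.map_apply,
      SymmetricAlgebra.equivMvPolynomial_ι_apply]
  exact DFunLike.congr_fun this F

theorem partialDeriv_map_xi (z : Basis (Fin n) ℂ (Dual ℂ V)) (h : V ≃ₗ[ℂ] V) (β : Fin n)
    (F : PolyAlg V) :
    partialDeriv (z.map (dualAct h)) β (xi h F) = xi h (partialDeriv z β F) := by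
  apply (SymmetricAlgebra.equivMvPolynomial (z.map (dualAct h))).injective
  rw [equivMvPolynomial_map_xi]
  simp [partialDeriv, equivMvPolynomial_map_xi]

theorem isUnit_jacobian_map {x : BasicInvariants G d} {z : Basis (Fin n) ℂ (Dual ℂ V)}
    {c : Fin n → ℂ} (hc : ∀ α, xi h (x.x α) = c α • (x.x α : PolyAlg V))
    (hu : IsUnit (jacobian x z q)) : IsUnit (jacobian x (z.map (dualAct h)) (h q)) := by
  -- The new Jacobian determinant divides a unit, so no `c α ≠ 0` has to be checked.
  have : Matrix.diagonal c * jacobian x (z.map (dualAct h)) (h q) = jacobian x z q := by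
    ext α β
    rw [Matrix.diagonal_mul, jacobian, jacobian, Matrix.of_apply, Matrix.of_apply,
      ← evalAt_apply_xi h _ q, ← partialDeriv_map_xi, hc, map_smul, map_smul, smul_eq_mul]
  rw [Matrix.isUnit_iff_isUnit_det] at hu ⊢
  rw [← this, Matrix.det_mul] at hu
  exact isUnit_of_mul_isUnit_right hu

theorem xi_eq_one_smul (hh : h ∈ G) (x : BasicInvariants G d) (α : Fin n) :
    xi h (x.x α) = (1 : ℂ) • (x.x α : PolyAlg V) := by
  rw [(x.x α).2 h hh, one_smul]

theorem xi_smulOfUnit_x (t : ℂˣ) (x : BasicInvariants G d) (α : Fin n) :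
    xi (LinearEquiv.smulOfUnit t : V ≃ₗ[ℂ] V) (x.x α) =
      (t : ℂ)⁻¹ ^ d α • (x.x α : PolyAlg V) :=
  xi_smulOfUnit t (x.homogeneous α)

/-- `ψ` sends `x^a` into weight `d · a`, so rescaling on the source matches the weighted rescaling
on the target. The latter preserves `V*`, which makes `goodSpace` stable under scalars. -/
theorem psi_xiInvariants_smulOfUnit (x : BasicInvariants G d) (z : Basis (Fin n) ℂ (Dual ℂ V))
    (q : V) (t : ℂˣ) (f : invariants G) :
    psi x z q (xiInvariants (LinearEquiv.smulOfUnit t) (xi_smulOfUnit_mem_invariants t) f) =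
      gradedScale d z (t : ℂ)⁻¹ (psi x z q f) := by
  suffices psi x z q ∘ₗ (xiInvariants (G := G) (LinearEquiv.smulOfUnit t)
      (xi_smulOfUnit_mem_invariants t)).toLinearMap =
      (gradedScale d z (t : ℂ)⁻¹).toLinearMap ∘ₗ psi x z q from DFunLike.congr_fun this f
  refine x.monomialBasis.ext fun a => ?_
  simp only [LinearMap.comp_apply, AlgHom.toLinearMap_apply,
    xiInvariants_smulOfUnit_monomialBasis, map_smul, psi_monomialBasis]
  rw [gradedScale_of_mem _ (gradedProj_mem _ _)]

theorem xiInvariants_smulOfUnit_mem_goodSpace_iff (x : BasicInvariants G d)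
    (z : Basis (Fin n) ℂ (Dual ℂ V)) (q : V) (t : ℂˣ) (f : invariants G) :
    xiInvariants (LinearEquiv.smulOfUnit t) (xi_smulOfUnit_mem_invariants t) f ∈
      goodSpace x z q ↔ f ∈ goodSpace x z q := by
  have h1 : ∀ (s : ℂˣ) (f : invariants G), f ∈ goodSpace x z q →
      xiInvariants (LinearEquiv.smulOfUnit s) (xi_smulOfUnit_mem_invariants s) f ∈
        goodSpace x z q := fun s f hf => by
    rw [goodSpace, Submodule.mem_comap, psi_xiInvariants_smulOfUnit]
    exact gradedScale_mem_linearForms _ hf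
  refine ⟨fun hf => ?_, h1 t f⟩
  have h2 := h1 t⁻¹ _ hf
  have h3 : xiInvariants (LinearEquiv.smulOfUnit t⁻¹) (xi_smulOfUnit_mem_invariants t⁻¹)
      (xiInvariants (LinearEquiv.smulOfUnit t) (xi_smulOfUnit_mem_invariants t) f) = f := by
    refine Subtype.ext ?_
    rw [coe_xiInvariants, coe_xiInvariants, ← xi_mul]
    have : (LinearEquiv.smulOfUnit t⁻¹ : V ≃ₗ[ℂ] V) * LinearEquiv.smulOfUnit t = 1 :=
      LinearEquiv.ext fun v => inv_smul_smul t v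
    rw [this, xi_one]
  rwa [h3] at h2

end equivariance

/-! ### Existence of adapted bases -/

section admissible

variable [FiniteDimensional ℂ V] {G : Subgroup (V ≃ₗ[ℂ] V)} {d : Fin n → ℕ} {g g' h : V ≃ₗ[ℂ] V}
  {ζ : ℂ} {q : V}

theorem IsAdmissible.exists_eigenbasis (hadm : IsAdmissible G d g ζ q) [Finite G]
    (hn : finrank ℂ V = n) :
    ∃ b : Basis (Fin n) ℂ V, ∀ i, g (b i) = ζ ^ (1 - (d i : ℤ)) • b i := by
  obtain ⟨m, hm, hg⟩ := isOfFinOrder_iff_pow_eq_one.mp (isOfFinOrder_of_finite (⟨g, hadm.mem⟩ : G))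
  have hg' : (g : V →ₗ[ℂ] V) ^ m = 1 := by
    have h1 : g ^ m = 1 := congrArg Subtype.val hg
    refine LinearMap.ext fun v => ?_
    have h2 : ∀ k : ℕ, ((g : V →ₗ[ℂ] V) ^ k) v = (g ^ k) v := fun k => by
      induction k with
      | zero => rfl
      | succ k ih =>
        rw [pow_succ', pow_succ', Module.End.mul_apply, ih]
        rfl
    rw [h2, h1]
    rfl
  obtain ⟨b, μ, hb⟩ := exists_eigenbasis_of_pow_eq_one hn _ hm.ne' hg'
  obtain ⟨σ, hσ⟩ := exists_equiv_of_prod_X_sub_C_eq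
    ((charpoly_eq_of_eigenbasis b hb).symm.trans hadm.eigenvalues)
  refine ⟨b.reindex σ, fun i => ?_⟩
  have := hb (σ.symm i)
  rw [Basis.reindex_apply, ← σ.apply_symm_apply i, hσ, σ.symm_apply_apply]
  exact this

theorem IsAdmissible.root_ne_zero (hadm : IsAdmissible G d g ζ q) : ζ ≠ 0 :=
  hadm.primitive.ne_zero hadm.topDegree_pos.ne'

theorem IsAdmissible.exists_isAdapted (hadm : IsAdmissible G d g ζ q) [Finite G]
    (hn : finrank ℂ V = n) : ∃ z : Basis (Fin n) ℂ (Dual ℂ V), IsAdapted d g ζ z := by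
  obtain ⟨b, hb⟩ := hadm.exists_eigenbasis hn
  -- The action on `V*` uses `g⁻¹`, which turns `ζ^{1 - d_α}` into `ζ^{d_α - 1}` on the dual basis.
  refine ⟨b.dualBasis, fun α => b.ext fun i => ?_⟩
  rw [dualAct_apply, inv_apply_of_eigenvector (zpow_ne_zero _ hadm.root_ne_zero) (hb i), map_smul,
    ← zpow_neg, neg_sub, LinearMap.smul_apply, Basis.dualBasis_apply_self]
  split_ifs with hi
  · rw [hi]
  · simp

/-! ### Transfer of admissibility -/

theorem IsAdmissible.conj (hadm : IsAdmissible G d g ζ q) (hmem : g' ∈ G) (hh : h * g = g' * h)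
    {c : Fin n → ℂ}
    (hc : ∀ (x : BasicInvariants G d) α, xi h (x.x α) = c α • (x.x α : PolyAlg V)) :
    IsAdmissible G d g' ζ (h q) where
  mem := hmem
  eigenvector := by
    rw [End.hasEigenvector_iff, End.mem_eigenspace_iff]
    refine ⟨?_, fun h0 => hadm.eigenvector.2 (h.map_eq_zero_iff.mp h0)⟩
    change (g' * h) q = _
    rw [← hh, LinearEquiv.mul_apply, ← map_smul]
    exact congrArg h hadm.eigenvector.apply_eq_smul
  primitive := hadm.primitive
  jacobian_invertible := by
    obtain ⟨x, z, hu⟩ := hadm.jacobian_invertible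
    exact ⟨x, _, isUnit_jacobian_map (hc x) hu⟩
  eigenvalues := by
    have : (g' : V →ₗ[ℂ] V) = h.conj (g : V →ₗ[ℂ] V) := by
      rw [← mul_inv_eq_iff_eq_mul.mpr hh]
      rfl
    rw [this, LinearEquiv.charpoly_conj, hadm.eigenvalues]

/-- An eigenbasis of `g` is one of `g^r`, with eigenvalues raised to the power `r`; coprimality
keeps `ζ^r` primitive. -/
theorem IsAdmissible.zpow (hadm : IsAdmissible G d g ζ q) [Finite G] (hn : finrank ℂ V = n)
    {r : ℤ} (hr : IsCoprime r (topDegree d : ℤ)) : IsAdmissible G d (g ^ r) (ζ ^ r) q where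
  mem := G.zpow_mem hadm.mem r
  eigenvector := by
    rw [End.hasEigenvector_iff, End.mem_eigenspace_iff]
    exact ⟨zpow_apply_of_eigenvector hadm.root_ne_zero hadm.eigenvector.apply_eq_smul r,
      hadm.eigenvector.2⟩
  primitive := hadm.primitive.zpow_of_gcd_eq_one r (Int.isCoprime_iff_gcd_eq_one.mp hr)
  jacobian_invertible := hadm.jacobian_invertible
  eigenvalues := by
    obtain ⟨b, hb⟩ := hadm.exists_eigenbasis hn
    refine charpoly_eq_of_eigenbasis b fun i => ?_
    rw [← zpow_mul, mul_comm, zpow_mul]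
    exact zpow_apply_of_eigenvector (zpow_ne_zero _ hadm.root_ne_zero) (hb i) r

theorem IsAdmissible.isAdapted_zpow (hadm : IsAdmissible G d g ζ q)
    {z : Basis (Fin n) ℂ (Dual ℂ V)} (hz : IsAdapted d g ζ z) (r : ℤ) :
    IsAdapted d (g ^ r) (ζ ^ r) z := fun α => by
  have hζ := zpow_ne_zero ((d α : ℤ) - 1) hadm.root_ne_zero
  have h1 : ∀ k : ℤ, (dualAct g ^ k) (z α) = (ζ ^ k) ^ ((d α : ℤ) - 1) • z α := fun k => by
    rw [zpow_apply_of_eigenvector hζ (hz α), ← zpow_mul, ← zpow_mul, mul_comm]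
  let D : (V ≃ₗ[ℂ] V) →* (Dual ℂ V ≃ₗ[ℂ] Dual ℂ V) :=
    { toFun := dualAct, map_one' := rfl, map_mul' := fun _ _ => rfl }
  rw [← h1]
  exact DFunLike.congr_fun (map_zpow D g r) (z α)

theorem IsAdmissible.smul (hadm : IsAdmissible G d g ζ q) (t : ℂˣ) :
    IsAdmissible G d g ζ ((t : ℂ) • q) :=
  hadm.conj hadm.mem (commute_smulOfUnit t g) (xi_smulOfUnit_x t)

/-! ### Equivalence of the transformed triplets -/

theorem IsAdmissible.tripletEquiv_conj (hadm : IsAdmissible G d g ζ q) (hh : h ∈ G) :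
    TripletEquiv G d g ζ q (h * g * h⁻¹) ζ (h q) := by
  have hhg : h * g = h * g * h⁻¹ * h := (inv_mul_cancel_right _ _).symm
  have hadm' := hadm.conj (G.mul_mem (G.mul_mem hh hadm.mem) (G.inv_mem hh)) hhg
    (xi_eq_one_smul hh)
  refine ⟨hadm, hadm', fun x x' z z' hz hz' => Submodule.ext fun f => ?_⟩
  have hpsi := hadm.psi_xi hadm' (xi_mem_invariants hh) hhg hz hz' x x' (xi_eq_one_smul hh x) f
  have hf : xiInvariants h (xi_mem_invariants hh) f = f := Subtype.ext (f.2 h hh)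
  rw [hf] at hpsi
  rw [goodSpace, goodSpace, Submodule.mem_comap, Submodule.mem_comap, hpsi, xi_mem_linearForms_iff]

/-- Equivariance only says that `ξ[t]` carries one good space to the other; its stability under
`ξ[t]` turns this into equality. -/
theorem IsAdmissible.tripletEquiv_smul (hadm : IsAdmissible G d g ζ q) (t : ℂˣ) :
    TripletEquiv G d g ζ q g ζ ((t : ℂ) • q) := by
  have hadm' := hadm.smul t
  refine ⟨hadm, hadm', fun x x' z z' hz hz' => Submodule.ext fun f => ?_⟩
  have hpsi := hadm.psi_xi (h := LinearEquiv.smulOfUnit t) hadm' (xi_smulOfUnit_mem_invariants t)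
    (commute_smulOfUnit t g) hz hz' x x' (xi_smulOfUnit_x t x) f
  rw [← xiInvariants_smulOfUnit_mem_goodSpace_iff x' z' ((t : ℂ) • q) t f, goodSpace, goodSpace,
    Submodule.mem_comap, Submodule.mem_comap, ← xi_mem_linearForms_iff (LinearEquiv.smulOfUnit t),
    ← hpsi]
  rfl

/-- `phi`, `psi` and `gradedPart` see the triplet only through `q` and the adapted basis. Both bases
are adapted to `(g^r, ζ^r, q)`, so independence for that triplet applies. -/
theorem IsAdmissible.zpow_independence (hadm : IsAdmissible G d g ζ q) [Finite G]
    (hn : finrank ℂ V = n) {r : ℤ} (hr : IsCoprime r (topDegree d : ℤ))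
    {z z' : Basis (Fin n) ℂ (Dual ℂ V)} (hz : IsAdapted d g ζ z)
    (hz' : IsAdapted d (g ^ r) (ζ ^ r) z') :
    (∀ j, gradedPart d z j = gradedPart d z' j) ∧ ∀ x x' : BasicInvariants G d,
      phi x z q = phi x' z' q ∧ psi x z q = psi x' z' q :=
  (hadm.zpow hn hr).independence (hadm.isAdapted_zpow hz r) hz'

end admissible

end GoodInv

end

open GoodInv
theorem proposition4p1 {V : Type*} [AddCommGroup V] [Module ℂ V] [FiniteDimensional ℂ V]
    {n : ℕ} (hn : Module.finrank ℂ V = n)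
    (G : Subgroup (V ≃ₗ[ℂ] V)) (hG : IsComplexReflectionGroup G)
    (d : Fin n → ℕ) (g : V ≃ₗ[ℂ] V) (ζ : ℂ) (q : V) (hadm : IsAdmissible G d g ζ q) :
    -- adapted bases, with which the gradings and morphisms below are computed, exist
    (∃ z : Module.Basis (Fin n) ℂ (Module.Dual ℂ V), IsAdapted d g ζ z) ∧
    -- (i) conjugation
    (∀ h ∈ G,
      IsAdmissible G d (h * g * h⁻¹) ζ (h q) ∧
      (linearForms V).map (xi h).toLinearMap = linearForms V ∧
      ∀ z z' : Module.Basis (Fin n) ℂ (Module.Dual ℂ V),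
        IsAdapted d g ζ z → IsAdapted d (h * g * h⁻¹) ζ z' →
        (∀ j, (gradedPart d z j).map (xi h).toLinearMap = gradedPart d z' j) ∧
        ∀ (x x' : BasicInvariants G d) (f : invariants G),
          ∃ hf : xi h f ∈ invariants G,
            phi x' z' (h q) ⟨xi h f, hf⟩ = xi h (phi x z q f) ∧
            psi x' z' (h q) ⟨xi h f, hf⟩ = xi h (psi x z q f)) ∧
    -- (ii) rescaling
    (∀ t : ℂˣ,
      IsAdmissible G d g ζ ((t : ℂ) • q) ∧
      (linearForms V).map (xi (LinearEquiv.smulOfUnit t : V ≃ₗ[ℂ] V)).toLinearMap =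
        linearForms V ∧
      ∀ z z' : Module.Basis (Fin n) ℂ (Module.Dual ℂ V),
        IsAdapted d g ζ z → IsAdapted d g ζ z' →
        (∀ j, (gradedPart d z j).map (xi (LinearEquiv.smulOfUnit t : V ≃ₗ[ℂ] V)).toLinearMap =
          gradedPart d z' j) ∧
        ∀ (x x' : BasicInvariants G d) (f : invariants G),
          ∃ hf : xi (LinearEquiv.smulOfUnit t : V ≃ₗ[ℂ] V) f ∈ invariants G,
            phi x' z' ((t : ℂ) • q) ⟨xi (LinearEquiv.smulOfUnit t : V ≃ₗ[ℂ] V) f, hf⟩ =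
              xi (LinearEquiv.smulOfUnit t : V ≃ₗ[ℂ] V) (phi x z q f) ∧
            psi x' z' ((t : ℂ) • q) ⟨xi (LinearEquiv.smulOfUnit t : V ≃ₗ[ℂ] V) f, hf⟩ =
              xi (LinearEquiv.smulOfUnit t : V ≃ₗ[ℂ] V) (psi x z q f)) ∧
    -- (iii) powers
    (∀ r : ℤ, IsCoprime r (topDegree d : ℤ) →
      IsAdmissible G d (g ^ r) (ζ ^ r) q ∧
      ∀ z z' : Module.Basis (Fin n) ℂ (Module.Dual ℂ V),
        IsAdapted d g ζ z → IsAdapted d (g ^ r) (ζ ^ r) z' →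
        (∀ j, gradedPart d z j = gradedPart d z' j) ∧
        ∀ x x' : BasicInvariants G d,
          phi x z q = phi x' z' q ∧ psi x z q = psi x' z' q) ∧
    -- the resulting equivalences of triplets
    (∀ h ∈ G, TripletEquiv G d g ζ q (h * g * h⁻¹) ζ (h q)) ∧
    (∀ t : ℂˣ, TripletEquiv G d g ζ q g ζ ((t : ℂ) • q)) ∧
    (∀ r : ℤ, IsCoprime r (topDegree d : ℤ) →
      TripletEquiv G d (g ^ r) (ζ ^ r) q g ζ q) := by

  have hfin : Finite G := hG.1
  refine ⟨hadm.exists_isAdapted hn, fun h hh => ?_, fun t => ?_, fun r hr => ?_,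
    fun h hh => hadm.tripletEquiv_conj hh, fun t => hadm.tripletEquiv_smul t, fun r hr => ?_⟩
  · have hhg : h * g = h * g * h⁻¹ * h := (inv_mul_cancel_right _ _).symm
    have hadm' := (hadm.tripletEquiv_conj hh).2.1
    refine ⟨hadm', map_xi_linearForms h, fun z z' hz hz' =>
      ⟨hz.map_gradedPart hz' hadm.primitive hadm.degree_pos hhg, fun x x' f =>
        ⟨xi_mem_invariants hh f f.2, ?_, ?_⟩⟩⟩
    · rw [phi_eq_phiHom, phi_eq_phiHom]
      exact hadm.phiHom_xi hadm' (xi_mem_invariants hh) x x' (xi_eq_one_smul hh x) f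
    · exact hadm.psi_xi hadm' (xi_mem_invariants hh) hhg hz hz' x x' (xi_eq_one_smul hh x) f
  · have hadm' := hadm.smul t
    refine ⟨hadm', map_xi_linearForms _, fun z z' hz hz' =>
      ⟨hz.map_gradedPart hz' hadm.primitive hadm.degree_pos (commute_smulOfUnit t g), fun x x' f =>
        ⟨xi_smulOfUnit_mem_invariants (G := G) t f f.2, ?_, ?_⟩⟩⟩
    · rw [phi_eq_phiHom, phi_eq_phiHom]
      exact hadm.phiHom_xi (h := LinearEquiv.smulOfUnit t) hadm' (xi_smulOfUnit_mem_invariants t)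
        x x' (xi_smulOfUnit_x t x) f
    · exact hadm.psi_xi (h := LinearEquiv.smulOfUnit t) hadm' (xi_smulOfUnit_mem_invariants t)
        (commute_smulOfUnit t g) hz hz' x x' (xi_smulOfUnit_x t x) f
  · exact ⟨hadm.zpow hn hr, fun z z' hz hz' => hadm.zpow_independence hn hr hz hz'⟩
  · refine ⟨hadm.zpow hn hr, hadm, fun x x' z z' hz hz' => ?_⟩
    -- The powered triplet stands on the left of the equivalence, hence the exchanged roles of `x,
    -- z` and `x', z'`.
    rw [goodSpace, goodSpace, ((hadm.zpow_independence hn hr hz' hz).2 x' x).2]
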